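/- **Setting.** Fix $a<b$, $N\ge 0$, $n=(n_0,\dots,n_N)\in\mathbb N^{N+1}$, and put $n_{\hat x}=\sum_i n_i$, $n_{S_i}=\sum_{j\ge i}n_j$, $n_S=\sum_{i=1}^N n_{S_i}$. Let $W_i[a,b]$ be the Sobolev space of functions whose derivatives up to order $i$ lie in $L_2[a,b]$, and $W^n=\prod_{i=0}^N W_i^{n_i}[a,b]$. For $\hat{\mathbf x}=(\hat{\mathbf x}_0,\dots,\hat{\mathbf x}_N)\in W^n$ let $\mathcal D\hat{\mathbf x}=\mathrm{col}(\hat{\mathbf x}_0,\partial_s\hat{\mathbf x}_1,\dots,\partial_s^N\hat{\mathbf x}_N)$; let $\mathcal F\hat{\mathbf x}$ be the list of all $\partial_s^j\hat{\mathbf x}_i$ with $0\le j\le i$ (grouped by increasing $j$), $\mathcal C\hat{\mathbf x}$ the list of all $\partial_s^j\hat{\mathbf x}_i$ with $0\le j<i$ (likewise), and $\mathcal B\hat{\mathbf x}=\mathrm{col}((\mathcal C\hat{\mathbf x})(a),(\mathcal C\hat{\mathbf x})(b))$. Norms: $\|(x,\hat{\mathbf x})\|^2_{\mathbb R^{n_x}\times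 W^n}=|x|^2+\sum_{i}\sum_{j\le i}\|\partial_s^j\hat{\mathbf x}_i\|_{L_2}^2$ and $\|(x,\mathbf v)\|^2_{\mathbb RL_2}=|x|^2+\|\mathbf v\|_{L_2}^2$ on $\mathbb RL_2=\mathbb R^{n_x}\times L_2^{n_{\hat x}}[a,b]$. **GPDE.** The data are: real matrices $A,B_{xw},B_{xu},B_{xr},C_z,D_{zw},D_{zu},D_{zr},C_y,D_{yw},D_{yu},D_{yr},C_v,D_{vw},D_{vu}$; matrices $B$ (of size $n_{BC}\times 2n_S$), $B_v$ and a square integrable matrix function $B_I$ on $[a,b]$; essentially bounded $A_0,B_{xv},B_{xb},C_r$, separable kernels $A_1,A_2$ (of the form $F(s)^{\mathsf T}G(\theta)$ with $F,G\in L_\infty$) and a matrix $D_{rb}$. The pair $(x,\hat{\mathbf x})\in\mathbb R^{n_x}\times W^n$ belongs to $\mathcal X_{w,u}$ if $$\int_a^b B_I(s)(\mathcal F\hat{\mathbf x})(s)\,ds+B_v v-B\,\mathcal B\hat{\mathbf x}=0,\qquad v=C_vx+D_{vw}w+D_{vu}u .$$ For inputs $w,u\in L_{2e}[\mathbb R_+]$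 with $B_vD_{vw}w,\,B_vD_{vu}u\in W_{1e}[\mathbb R_+]$ and an initial condition $(x^0,\hat{\mathbf x}^0)\in\mathcal X_{w(0),u(0)}$, a solution $(x,\hat{\mathbf x},z,y,v,r)$ of the GPDE satisfies: $z,y,v,r\in L_{2e}[\mathbb R_+]$; $(x(t),\hat{\mathbf x}(t))\in\mathcal X_{w(t),u(t)}$ for all $t\ge0$; $x(0)=x^0$, $\hat{\mathbf x}(0)=\hat{\mathbf x}^0$; $x$ is differentiable, and $\hat{\mathbf x}$ is differentiable in the $L_2$ norm, at almost every $t\geq 0$; and for almost every $t\ge0$ $$\dot x=Ax+B_{xw}w+B_{xu}u+B_{xr}r,\quad z=C_zx+D_{zw}w+D_{zu}u+D_{zr}r,\quad y=C_yx+D_{yw}w+D_{yu}u+D_{yr}r,\quad v=C_vx+D_{vw}w+D_{vu}u,$$ $$\dot{\hat{\mathbf x}}(t,s)=A_0(s)(\mathcal F\hat{\mathbf x}(t))(s)+\int_a^sA_1(s,\theta)(\mathcal F\hat{\mathbf x}(t))(\theta)d\theta+\int_s^bA_2(s,\theta)(\mathcal F\hat{\mathbf x}(t))(\theta)d\theta+B_{xv}(s)v(t)+B_{xb}(s)\mathcal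 B\hat{\mathbf x}(t),$$ $$r(t)=\int_a^bC_r(\theta)(\mathcal F\hat{\mathbf x}(t))(\theta)d\theta+D_{rb}\,\mathcal B\hat{\mathbf x}(t).$$ **Admissibility.** Let $\tau_i(s)=s^i/i!$. Let $T(s)$, $Q(s)$ be the matrices such that $(\mathcal C\hat{\mathbf x})(s)=T(s-a)(\mathcal C\hat{\mathbf x})(a)+\int_a^sQ(s-\theta)(\mathcal D\hat{\mathbf x})(\theta)d\theta$ is Taylor's formula, i.e. in the rows belonging to $\partial_s^j\hat{\mathbf x}_i$, $T(s)$ has the blocks $\tau_{k-j}(s)I$ in the columns of $\partial_s^k\hat{\mathbf x}_i$, $j\le k<i$, and $Q(s)$ has the block $\tau_{i-1-j}(s)I$ in the columns of $\partial_s^i\hat{\mathbf x}_i$, all other entries being zero. Let $T_1,Q_1$ be the rows of $T,Q$ with $j=0$, and $U_1,U_2$ the $0$–$1$ matrices with $\mathcal F\hat{\mathbf x}=U_1\mathcal D\hat{\mathbf x}+U_2\mathcal C\hat{\mathbf x}$. The GPDE is *admissible* if $$B_T=B\begin{bmatrix}T(0)\\T(b-a)\end{bmatrix}-\int_a^bB_I(s)U_2T(s-a)\,ds$$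 is invertible (so $n_{BC}=n_S$). **Associated PIE.** Write $\mathcal P[P,Q_1;Q_2,\{R_0,R_1,R_2\}]$ for the 4-PI operator sending $(u,\mathbf v)$ to the pair $$Pu+\int_a^bQ_1\mathbf v\,d\theta,\qquad Q_2(s)u+R_0(s)\mathbf v(s)+\int_a^sR_1(s,\theta)\mathbf v(\theta)d\theta+\int_s^bR_2(s,\theta)\mathbf v(\theta)d\theta .$$ Put $$B_Q(s)=B_T^{-1}\Big(B_I(s)U_1+\int_s^bB_I(\theta)U_2Q(\theta-s)d\theta-B\begin{bmatrix}0\\Q(b-s)\end{bmatrix}\Big),\quad G_v(s)=\begin{bmatrix}0\\T_1(s-a)B_T^{-1}B_v\end{bmatrix},$$ $$G_0=\mathrm{diag}(I_{n_0},0),\quad G_2(s,\theta)=\begin{bmatrix}0\\T_1(s-a)B_Q(\theta)\end{bmatrix},\quad G_1(s,\theta)=G_2(s,\theta)+\begin{bmatrix}0\\Q_1(s-\theta)\end{bmatrix},$$ $R_{D,2}(s,\theta)=U_2T(s-a)B_Q(\theta)$ and $R_{D,1}(s,\theta)=R_{D,2}(s,\theta)+U_2Q(s-\theta)$. Let $[D_{rv},C_{rx};\hat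 B_{xv},\{\hat A_i\}]$ be the parameters of the composition $\mathcal P[\Xi]\,\mathcal P[\Upsilon]$, where $\Xi=[\,(0\ D_{rb}),C_r;(B_{xv}\ B_{xb}),\{A_i\}]$ and $$\Upsilon=\left[\begin{bmatrix}I\\B_T^{-1}B_v\\T(b-a)B_T^{-1}B_v\end{bmatrix},\begin{bmatrix}0\\B_Q(s)\\T(b-a)B_Q(s)+Q(b-s)\end{bmatrix};\ U_2T(s-a)B_T^{-1}B_v,\ \{U_1,R_{D,1},R_{D,2}\}\right].$$ The associated PIE has the operators $\mathcal T=\mathcal P[I,0;G_vC_v,\{G_i\}]$, $\mathcal T_w=\mathrm{col}(0,G_vD_{vw})$, $\mathcal T_u=\mathrm{col}(0,G_vD_{vu})$, $\mathcal A=\mathcal P[A+B_{xr}D_{rv}C_v,\,B_{xr}C_{rx};\,\hat B_{xv}C_v,\{\hat A_i\}]$, $\mathcal B_1=\mathrm{col}(B_{xw}+B_{xr}D_{rv}D_{vw},\hat B_{xv}D_{vw})$, $\mathcal B_2=\mathrm{col}(B_{xu}+B_{xr}D_{rv}D_{vu},\hat B_{xv}D_{vu})$, and, for $(i,q)=(1,z),(2,y)$,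 $\mathcal C_i(x,\mathbf v)=(C_q+D_{qr}D_{rv}C_v)x+\int_a^bD_{qr}C_{rx}\mathbf v$, $\mathcal D_{i1}=D_{qw}+D_{qr}D_{rv}D_{vw}$, $\mathcal D_{i2}=D_{qu}+D_{qr}D_{rv}D_{vu}$. For inputs $w,u\in L_{2e}$ with $\mathcal T_ww,\mathcal T_uu\in W_{1e}$, a solution $(\underline{\mathbf x},z,y)$ of the PIE with initial condition $\underline{\mathbf x}^0\in\mathbb RL_2$ satisfies: $\underline{\mathbf x}(t)\in\mathbb RL_2$ for all $t\ge0$, $\underline{\mathbf x}(0)=\underline{\mathbf x}^0$, $z,y\in L_{2e}$, $\mathcal T\underline{\mathbf x}$ is differentiable in $\mathbb RL_2$ at almost every $t\ge 0$, and for almost every $t\geq 0$ $$\partial_t(\mathcal T\underline{\mathbf x})=\mathcal A\underline{\mathbf x}+\mathcal B_1w+\mathcal B_2u-\partial_t(\mathcal T_ww)-\partial_t(\mathcal T_uu),\quad z=\mathcal C_1\underline{\mathbf x}+\mathcal D_{11}w+\mathcal D_{12}u,\quad y=\mathcal C_2\underline{\mathbf x}+\mathcal D_{21}w+\mathcal D_{22}u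 .$$ **Strong solutions.** A solution of the GPDE is called *strong* if moreover $x$ and $\hat{\mathbf x}$ are locally absolutely continuous on $\mathbb R_+$ with values in $\mathbb R^{n_x}$ and $L_2$, and $\hat{\mathbf x}$ is locally square integrable in time with values in $W^n$. A solution of the PIE is called *strong* if moreover $\mathcal T\underline{\mathbf x}$ is locally absolutely continuous on $\mathbb R_+$ with values in $\mathbb RL_2$, and $\underline{\mathbf x}$ is locally square integrable in time with values in $\mathbb RL_2$. **Exponential stability.** The GPDE is exponentially stable if there are $M,\alpha>0$ such that every solution with inputs $w=u=0$ and initial condition $(x^0,\hat{\mathbf x}^0)\in\mathcal X_{0,0}$ satisfies $\|(x(t),\hat{\mathbf x}(t))\|_{\mathbb R^{n_x}\times W^n}\le M\|(x^0,\hat{\mathbf x}^0)\|_{\mathbb R^{n_x}\times W^n}e^{-\alpha t}$ for all $t\ge0$. The PIE is exponentially stable if there are $M,\alpha>0$ such that every solution with inputs $w=u=0$ and initial condition $\underline{\mathbf x}^0\in\mathbb RL_2$ satisfies $\|\underline{\mathbf x}(t)\|_{\mathbb RL_2}\le M\|\underline{\mathbf x}^0\|_{\mathbb RL_2}e^{-\alpha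 t}$ for all $t\ge0$. **Theorem.** If the GPDE is admissible, then the GPDE is exponentially stable if and only if the associated PIE is exponentially stable. This holds both when "solution" means any solution and when, on both sides, it means strong solution. -/

import Mathlib

open MeasureTheory Set
open scoped Matrix

noncomputable section

namespace GPDE

/-! ### Function spaces -/

/-- `ℝ^ι` with the Euclidean norm. -/
abbrev Vec (ι : Type) := EuclideanSpace ℝ ι

/-- Lebesgue measure on the spatial interval `[a, b]`. -/
abbrev vol (a b : ℝ) : Measure ℝ := volume.restrict (Icc a b)

/-- The Hilbert space `L₂([a, b]; ℝ^ι)`. -/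
abbrev L2 (a b : ℝ) (ι : Type) [Fintype ι] := Lp (Vec ι) 2 (vol a b)

/-- The Hilbert space `ℝL₂ = ℝ^m × L₂([a, b]; ℝ^ι)`, with
`‖(x, f)‖² = ‖x‖² + ‖f‖²`. -/
abbrev RL2 (a b : ℝ) (m ι : Type) [Fintype m] [Fintype ι] :=
  WithLp 2 (Vec m × L2 a b ι)

open Classical in
/-- The class in `L₂` of a square integrable function (`0` if `f` is not square integrable;
with the regularity of the parameters imposed below this case does not occur). -/
def toL2 (a b : ℝ) {ι : Type} [Fintype ι] (f : ℝ → Vec ι) : L2 a b ι :=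
  if h : MemLp f 2 (vol a b) then h.toLp f else 0

/-- `L_{2e}[ℝ₊]`: functions of time which are square integrable on every `[0, τ]`. -/
def L2e {E : Type} [NormedAddCommGroup E] (f : ℝ → E) : Prop :=
  ∀ τ : ℝ, MemLp f 2 (volume.restrict (Icc 0 τ))

/-- `W_{1e}[ℝ₊]`: functions of time which are primitives of functions in `L_{2e}`, that is, which
are locally absolutely continuous on `[0, ∞)` with derivative in `L_{2e}`. -/
def W1e {E : Type} [NormedAddCommGroup E] [NormedSpace ℝ E] (f : ℝ → E) : Prop :=
  ∃ g : ℝ → E, L2e g ∧ ∀ t : ℝ, 0 ≤ t → f t = f 0 + ∫ τ in (0 : ℝ)..t, g τ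

/-- Local absolute continuity on `[0, ∞)`. -/
def LocAC {E : Type} [NormedAddCommGroup E] (f : ℝ → E) : Prop :=
  ∀ τ : ℝ, 0 ≤ τ → AbsolutelyContinuousOnInterval f 0 τ

/-! ### Matrices and matrix-valued functions -/

/-- Matrix times Euclidean vector. -/
def mv {m n : Type} [Fintype n] (M : Matrix m n ℝ) (x : Vec n) : Vec m :=
  WithLp.toLp 2 (M *ᵥ x.ofLp)

/-- Entrywise integral of a matrix-valued function. -/
def matInt {m n : Type} (a b : ℝ) (M : ℝ → Matrix m n ℝ) : Matrix m n ℝ :=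
  Matrix.of fun i j => ∫ s in a..b, M s i j

/-- Essentially bounded measurable matrix-valued functions on `[a, b]`. -/
def MemLinfMat {m n : Type} (a b : ℝ) (M : ℝ → Matrix m n ℝ) : Prop :=
  ∀ i j, MemLp (fun s => M s i j) ⊤ (vol a b)

/-- Square integrable matrix-valued functions on `[a, b]`. -/
def MemL2Mat {m n : Type} (a b : ℝ) (M : ℝ → Matrix m n ℝ) : Prop :=
  ∀ i j, MemLp (fun s => M s i j) 2 (vol a b)

/-- Separable kernels `R(s, θ) = F(s)ᵀ G(θ)` with `F, G` in `L_∞`. -/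
def SeparableKernel {m n : Type} (a b : ℝ) (R : ℝ → ℝ → Matrix m n ℝ) : Prop :=
  ∃ (r : ℕ) (F : ℝ → Matrix (Fin r) m ℝ) (G : ℝ → Matrix (Fin r) n ℝ),
    MemLinfMat a b F ∧ MemLinfMat a b G ∧
      ∀ s ∈ Icc a b, ∀ θ ∈ Icc a b, R s θ = (F s)ᵀ * G θ

/-- A (possibly not square) matrix with a two-sided inverse. -/
def IsInvertible {m n : Type} [Fintype m] [Fintype n] [DecidableEq m] [DecidableEq n]
    (M : Matrix m n ℝ) : Prop :=
  ∃ C : Matrix n m ℝ, M * C = 1 ∧ C * M = 1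

open Classical in
/-- The inverse of an invertible matrix (`0` if there is none). -/
def matInv {m n : Type} [Fintype m] [Fintype n] [DecidableEq m] [DecidableEq n]
    (M : Matrix m n ℝ) : Matrix n m ℝ :=
  if h : IsInvertible M then h.choose else 0

/-! ### PI operators -/

/-- The parameters `[P, Q₁; Q₂, {R₀, R₁, R₂}]` of a 4-PI operator from
`ℝ^n × L₂^q` to `ℝ^m × L₂^p`. -/
structure PIParam (m p n q : Type) where
  P : Matrix m n ℝ
  Q1 : ℝ → Matrix m q ℝ
  Q2 : ℝ → Matrix p n ℝ
  R0 : ℝ → Matrix p q ℝ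
  R1 : ℝ → ℝ → Matrix p q ℝ
  R2 : ℝ → ℝ → Matrix p q ℝ

namespace PIParam

variable {m p n q k l : Type} [Fintype m] [Fintype p] [Fintype n] [Fintype q] [Fintype k]
  [Fintype l]

/-- Finite-dimensional part `P u + ∫ₐᵇ Q₁(θ) v(θ) dθ`. -/
def finPart (K : PIParam m p n q) (a b : ℝ) (u : Vec n) (v : ℝ → Vec q) : Vec m :=
  mv K.P u + WithLp.toLp 2 fun i => ∫ θ in a..b, mv (K.Q1 θ) (v θ) i

/-- Distributed part
`Q₂(s) u + R₀(s) v(s) + ∫ₐˢ R₁(s,θ) v(θ) dθ + ∫ₛᵇ R₂(s,θ) v(θ) dθ`. -/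
def distPart (K : PIParam m p n q) (a b : ℝ) (u : Vec n) (v : ℝ → Vec q) (s : ℝ) : Vec p :=
  mv (K.Q2 s) u + mv (K.R0 s) (v s)
    + (WithLp.toLp 2 fun i => ∫ θ in a..s, mv (K.R1 s θ) (v θ) i)
    + (WithLp.toLp 2 fun i => ∫ θ in s..b, mv (K.R2 s θ) (v θ) i)

/-- The 4-PI operator with the given parameters. -/
def op (K : PIParam m p n q) (a b : ℝ) (x : RL2 a b n q) : RL2 a b m p :=
  WithLp.toLp 2 (K.finPart a b x.fst x.snd, toL2 a b (K.distPart a b x.fst x.snd))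

/-- The action on a finite-dimensional input, for operators without distributed input. -/
def opVec (K : PIParam m p n (Fin 0)) (a b : ℝ) (w : Vec n) : RL2 a b m p :=
  K.op a b (WithLp.toLp 2 (w, 0))

/-- The composition map on the parameters of 4-PI operators. -/
def comp (a b : ℝ) (K : PIParam m p k l) (L : PIParam k l n q) : PIParam m p n q where
  P := K.P * L.P + matInt a b fun s => K.Q1 s * L.Q2 s
  Q1 := fun s => K.P * L.Q1 s + K.Q1 s * L.R0 s
    + (matInt s b fun η => K.Q1 η * L.R1 η s) + (matInt a s fun η => K.Q1 η * L.R2 η s)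
  Q2 := fun s => K.Q2 s * L.P + K.R0 s * L.Q2 s
    + (matInt a s fun η => K.R1 s η * L.Q2 η) + (matInt s b fun η => K.R2 s η * L.Q2 η)
  R0 := fun s => K.R0 s * L.R0 s
  R1 := fun s η => K.Q2 s * L.Q1 η + K.R0 s * L.R1 s η + K.R1 s η * L.R0 η
    + (matInt a η fun θ => K.R1 s θ * L.R2 θ η) + (matInt η s fun θ => K.R1 s θ * L.R1 θ η)
    + (matInt s b fun θ => K.R2 s θ * L.R1 θ η)
  R2 := fun s η => K.Q2 s * L.Q1 η + K.R0 s * L.R2 s η + K.R2 s η * L.R0 η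
    + (matInt a s fun θ => K.R1 s θ * L.R2 θ η) + (matInt s η fun θ => K.R2 s θ * L.R2 θ η)
    + (matInt η b fun θ => K.R2 s θ * L.R1 θ η)

end PIParam

/-! ### PIE systems -/

/-- The twelve 4-PI parameters of a PIE system with state in `ℝ^nx × L₂^X`, disturbance in
`ℝ^nw`, control in `ℝ^nu`, regulated output in `ℝ^nz` and sensed output in `ℝ^ny`. -/
structure PIESystem (nx : ℕ) (X : Type) (nw nu nz ny : ℕ) where
  T : PIParam (Fin nx) X (Fin nx) X
  Tw : PIParam (Fin nx) X (Fin nw) (Fin 0)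
  Tu : PIParam (Fin nx) X (Fin nu) (Fin 0)
  A : PIParam (Fin nx) X (Fin nx) X
  B1 : PIParam (Fin nx) X (Fin nw) (Fin 0)
  B2 : PIParam (Fin nx) X (Fin nu) (Fin 0)
  C1 : PIParam (Fin nz) (Fin 0) (Fin nx) X
  C2 : PIParam (Fin ny) (Fin 0) (Fin nx) X
  D11 : PIParam (Fin nz) (Fin 0) (Fin nw) (Fin 0)
  D12 : PIParam (Fin nz) (Fin 0) (Fin nu) (Fin 0)
  D21 : PIParam (Fin ny) (Fin 0) (Fin nw) (Fin 0)
  D22 : PIParam (Fin ny) (Fin 0) (Fin nu) (Fin 0)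

namespace PIESystem

variable {nx nw nu nz ny : ℕ} {X : Type} [Fintype X]

/-- `{x, z, y}` satisfies the PIE on `[a, b]` with initial condition `x0` and input `{w, u}`.
The derivative `T ẋ` is the derivative of `t ↦ T x(t)` in the norm of `ℝL₂` (differentiability of
`x` in the `T`-norm), and `T_w ẇ`, `T_u u̇` are the time derivatives of `T_w w`, `T_u u`. -/
structure IsSolution (S : PIESystem nx X nw nu nz ny) (a b : ℝ)
    (x0 : RL2 a b (Fin nx) X) (w : ℝ → Vec (Fin nw)) (u : ℝ → Vec (Fin nu))
    (x : ℝ → RL2 a b (Fin nx) X) (z : ℝ → Vec (Fin nz)) (y : ℝ → Vec (Fin ny)) : Prop where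
  w_mem : L2e w
  u_mem : L2e u
  Tw_mem : W1e fun t => S.Tw.opVec a b (w t)
  Tu_mem : W1e fun t => S.Tu.opVec a b (u t)
  z_mem : L2e z
  y_mem : L2e y
  init : x 0 = x0
  state_eq : ∀ᵐ t ∂(volume.restrict (Ici (0 : ℝ))),
    HasDerivAt (fun τ => S.T.op a b (x τ))
      (S.A.op a b (x t) + S.B1.opVec a b (w t) + S.B2.opVec a b (u t)
        - deriv (fun τ => S.Tw.opVec a b (w τ)) t - deriv (fun τ => S.Tu.opVec a b (u τ)) t) t
  z_eq : ∀ᵐ t ∂(volume.restrict (Ici (0 : ℝ))),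
    z t = (S.C1.op a b (x t)).fst + (S.D11.opVec a b (w t)).fst + (S.D12.opVec a b (u t)).fst
  y_eq : ∀ᵐ t ∂(volume.restrict (Ici (0 : ℝ))),
    y t = (S.C2.op a b (x t)).fst + (S.D21.opVec a b (w t)).fst + (S.D22.opVec a b (u t)).fst

/-- Strong solutions: in addition `T x` is locally absolutely continuous in time with values in
`ℝL₂` and `x` is locally square integrable in time with values in `ℝL₂`. -/
structure IsStrongSolution (S : PIESystem nx X nw nu nz ny) (a b : ℝ)
    (x0 : RL2 a b (Fin nx) X) (w : ℝ → Vec (Fin nw)) (u : ℝ → Vec (Fin nu))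
    (x : ℝ → RL2 a b (Fin nx) X) (z : ℝ → Vec (Fin nz)) (y : ℝ → Vec (Fin ny)) : Prop
    extends IsSolution S a b x0 w u x z y where
  Tx_ac : LocAC fun t => S.T.op a b (x t)
  x_mem : L2e x

/-- Exponential stability of a PIE in the `ℝL₂` norm. -/
def ExpStable (S : PIESystem nx X nw nu nz ny) (a b : ℝ) : Prop :=
  ∃ M α : ℝ, 0 < M ∧ 0 < α ∧ ∀ (x0 : RL2 a b (Fin nx) X) (x : ℝ → RL2 a b (Fin nx) X)
    (z : ℝ → Vec (Fin nz)) (y : ℝ → Vec (Fin ny)),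
    S.IsSolution a b x0 0 0 x z y →
      ∀ t : ℝ, 0 ≤ t → ‖x t‖ ≤ M * ‖x0‖ * Real.exp (-α * t)

/-- Exponential stability of a PIE in the `ℝL₂` norm, for strong solutions. -/
def ExpStableStrong (S : PIESystem nx X nw nu nz ny) (a b : ℝ) : Prop :=
  ∃ M α : ℝ, 0 < M ∧ 0 < α ∧ ∀ (x0 : RL2 a b (Fin nx) X) (x : ℝ → RL2 a b (Fin nx) X)
    (z : ℝ → Vec (Fin nz)) (y : ℝ → Vec (Fin ny)),
    S.IsStrongSolution a b x0 0 0 x z y →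
      ∀ t : ℝ, 0 ≤ t → ‖x t‖ ≤ M * ‖x0‖ * Real.exp (-α * t)

end PIESystem

/-! ### The Sobolev state space `Wⁿ` -/

section Sobolev

variable {N : ℕ}

/-- Index of the scalar components of `x̂ = (x̂₀, …, x̂_N)`; `⟨i, k⟩` is the `k`-th entry of
`x̂ᵢ ∈ W_i^{n_i}`. There are `n₀ + … + n_N` of them. -/
abbrev XIdx (n : Fin (N + 1) → ℕ) := Σ i : Fin (N + 1), Fin (n i)

/-- Index of the entries of `F x̂`: `⟨x, j⟩` stands for `∂ₛʲ x̂_x`, where `j ≤ i` for an entry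
`x` of `x̂ᵢ`. -/
abbrev FIdx (n : Fin (N + 1) → ℕ) := Σ x : XIdx n, Fin ((x.1 : ℕ) + 1)

/-- Index of the entries of `C x̂`: `⟨x, j⟩` stands for `∂ₛʲ x̂_x`, where `j < i` for an entry
`x` of `x̂ᵢ`. There are `n_S = ∑ᵢ i nᵢ` of them. -/
abbrev CIdx (n : Fin (N + 1) → ℕ) := Σ x : XIdx n, Fin (x.1 : ℕ)

/-- Index of the boundary values: the left ones, then the right ones. -/
abbrev BIdx (n : Fin (N + 1) → ℕ) := CIdx n ⊕ CIdx n

/-- An element `x̂` of `Wⁿ[a, b] = ∏ᵢ W_i^{n_i}[a, b]`, given with its derivatives: `F s ⟨x, j⟩` is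
`∂ₛʲ x̂_x (s)`. All derivatives listed are square integrable, and each derivative of order `j < i`
of an entry of `x̂ᵢ` is (the continuous representative which is) the primitive of the next one. -/
structure Sob (a b : ℝ) (n : Fin (N + 1) → ℕ) where
  F : ℝ → Vec (FIdx n)
  memLp : MemLp F 2 (vol a b)
  ftc : ∀ c : CIdx n, ∀ s ∈ Icc a b,
    F s ⟨c.1, c.2.castSucc⟩ = F a ⟨c.1, c.2.castSucc⟩ + ∫ θ in a..s, F θ ⟨c.1, c.2.succ⟩

variable {a b : ℝ} {n : Fin (N + 1) → ℕ}

/-- The class of `F x̂` in `L₂`; it determines `x̂` as an element of `Wⁿ`, and its norm is the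
Sobolev norm of `x̂`. -/
def Sob.jet (f : Sob a b n) : L2 a b (FIdx n) := f.memLp.toLp f.F

/-- `x̂` as an element of `L₂`. -/
def Sob.state (f : Sob a b n) : L2 a b (XIdx n) :=
  toL2 a b fun s => WithLp.toLp 2 fun x => f.F s ⟨x, 0⟩

/-- `B x̂ = ((C x̂)(a), (C x̂)(b))`, the vector of boundary values. -/
def Sob.bdry (f : Sob a b n) : Vec (BIdx n) :=
  WithLp.toLp 2 (Sum.elim (fun c => f.F a ⟨c.1, c.2.castSucc⟩)
    (fun c => f.F b ⟨c.1, c.2.castSucc⟩))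

end Sobolev

/-! ### GPDE models -/

/-- Boundary condition parameters `{B, B_I, B_v}`. -/
structure BCParam {N : ℕ} (a b : ℝ) (n : Fin (N + 1) → ℕ) (nBC nv : ℕ) where
  B : Matrix (Fin nBC) (BIdx n) ℝ
  BI : ℝ → Matrix (Fin nBC) (FIdx n) ℝ
  Bv : Matrix (Fin nBC) (Fin nv) ℝ
  BI_mem : MemL2Mat a b BI

/-- Parameters of the in-domain dynamics of the PDE subsystem. -/
structure PDEParam {N : ℕ} (a b : ℝ) (n : Fin (N + 1) → ℕ) (nv nr : ℕ) where
  A0 : ℝ → Matrix (XIdx n) (FIdx n) ℝ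
  A1 : ℝ → ℝ → Matrix (XIdx n) (FIdx n) ℝ
  A2 : ℝ → ℝ → Matrix (XIdx n) (FIdx n) ℝ
  Bxv : ℝ → Matrix (XIdx n) (Fin nv) ℝ
  Bxb : ℝ → Matrix (XIdx n) (BIdx n) ℝ
  Cr : ℝ → Matrix (Fin nr) (FIdx n) ℝ
  Drb : Matrix (Fin nr) (BIdx n) ℝ
  A0_mem : MemLinfMat a b A0
  A1_sep : SeparableKernel a b A1
  A2_sep : SeparableKernel a b A2
  Bxv_mem : MemLinfMat a b Bxv
  Bxb_mem : MemLinfMat a b Bxb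
  Cr_mem : MemLinfMat a b Cr

/-- Parameters of the ODE subsystem. -/
structure ODEParam (nx nw nu nr nz ny nv : ℕ) where
  A : Matrix (Fin nx) (Fin nx) ℝ
  Bxw : Matrix (Fin nx) (Fin nw) ℝ
  Bxu : Matrix (Fin nx) (Fin nu) ℝ
  Bxr : Matrix (Fin nx) (Fin nr) ℝ
  Cz : Matrix (Fin nz) (Fin nx) ℝ
  Dzw : Matrix (Fin nz) (Fin nw) ℝ
  Dzu : Matrix (Fin nz) (Fin nu) ℝ
  Dzr : Matrix (Fin nz) (Fin nr) ℝ
  Cy : Matrix (Fin ny) (Fin nx) ℝ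
  Dyw : Matrix (Fin ny) (Fin nw) ℝ
  Dyu : Matrix (Fin ny) (Fin nu) ℝ
  Dyr : Matrix (Fin ny) (Fin nr) ℝ
  Cv : Matrix (Fin nv) (Fin nx) ℝ
  Dvw : Matrix (Fin nv) (Fin nw) ℝ
  Dvu : Matrix (Fin nv) (Fin nu) ℝ

/-- `X_v`: the boundary conditions
`∫ₐᵇ B_I(s) (F x̂)(s) ds + B_v v - B (B x̂) = 0`. -/
def BCParam.Holds {N : ℕ} {a b : ℝ} {n : Fin (N + 1) → ℕ} {nBC nv : ℕ}
    (Gb : BCParam a b n nBC nv) (v : Vec (Fin nv)) (f : Sob a b n) : Prop :=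
  ∀ i, (∫ s in a..b, mv (Gb.BI s) (f.F s) i) + mv Gb.Bv v i - mv Gb.B f.bdry i = 0

/-- Right-hand side of the in-domain dynamics, as a function of `s`. -/
def PDEParam.rhs {N : ℕ} {a b : ℝ} {n : Fin (N + 1) → ℕ} {nv nr : ℕ}
    (Gp : PDEParam a b n nv nr) (f : Sob a b n) (v : Vec (Fin nv)) (s : ℝ) : Vec (XIdx n) :=
  mv (Gp.A0 s) (f.F s) + mv (Gp.Bxv s) v + mv (Gp.Bxb s) f.bdry
    + (WithLp.toLp 2 fun i => ∫ θ in a..s, mv (Gp.A1 s θ) (f.F θ) i)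
    + (WithLp.toLp 2 fun i => ∫ θ in s..b, mv (Gp.A2 s θ) (f.F θ) i)

/-- The output `r` of the PDE subsystem. -/
def PDEParam.out {N : ℕ} {a b : ℝ} {n : Fin (N + 1) → ℕ} {nv nr : ℕ}
    (Gp : PDEParam a b n nv nr) (f : Sob a b n) : Vec (Fin nr) :=
  mv Gp.Drb f.bdry + WithLp.toLp 2 fun i => ∫ θ in a..b, mv (Gp.Cr θ) (f.F θ) i

/-- A GPDE model on `[a, b]`, for a given continuity constraint `n`. -/
structure Model {N : ℕ} (a b : ℝ) (n : Fin (N + 1) → ℕ) (nBC nx nw nu nr nz ny nv : ℕ) where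
  Go : ODEParam nx nw nu nr nz ny nv
  Gb : BCParam a b n nBC nv
  Gp : PDEParam a b n nv nr

namespace Model

variable {N : ℕ} {a b : ℝ} {n : Fin (N + 1) → ℕ} {nBC nx nw nu nr nz ny nv : ℕ}

/-- `{x, x̂} ∈ 𝒳_{w,u}`: the boundary conditions hold with `v = C_v x + D_vw w + D_vu u`. -/
def InDomain (G : Model a b n nBC nx nw nu nr nz ny nv) (w : Vec (Fin nw)) (u : Vec (Fin nu))
    (x : Vec (Fin nx)) (f : Sob a b n) : Prop :=
  G.Gb.Holds (mv G.Go.Cv x + mv G.Go.Dvw w + mv G.Go.Dvu u) f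

/-- `{x, x̂, z, y, v, r}` satisfies the GPDE with initial condition `{x0, f0}` and input `{w, u}`.
The PDE state is differentiated in time in the norm of `L₂`. -/
structure IsSolution (G : Model a b n nBC nx nw nu nr nz ny nv)
    (x0 : Vec (Fin nx)) (f0 : Sob a b n) (w : ℝ → Vec (Fin nw)) (u : ℝ → Vec (Fin nu))
    (x : ℝ → Vec (Fin nx)) (f : ℝ → Sob a b n) (z : ℝ → Vec (Fin nz)) (y : ℝ → Vec (Fin ny))
    (v : ℝ → Vec (Fin nv)) (r : ℝ → Vec (Fin nr)) : Prop where
  init_dom : G.InDomain (w 0) (u 0) x0 f0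
  w_mem : L2e w
  u_mem : L2e u
  Bw_mem : W1e fun t => mv (G.Gb.Bv * G.Go.Dvw) (w t)
  Bu_mem : W1e fun t => mv (G.Gb.Bv * G.Go.Dvu) (u t)
  z_mem : L2e z
  y_mem : L2e y
  v_mem : L2e v
  r_mem : L2e r
  dom : ∀ t : ℝ, 0 ≤ t → G.InDomain (w t) (u t) (x t) (f t)
  init_x : x 0 = x0
  init_f : (f 0).jet = f0.jet
  x_eq : ∀ᵐ t ∂(volume.restrict (Ici (0 : ℝ))),
    HasDerivAt x
      (mv G.Go.A (x t) + mv G.Go.Bxw (w t) + mv G.Go.Bxu (u t) + mv G.Go.Bxr (r t)) t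
  z_eq : ∀ᵐ t ∂(volume.restrict (Ici (0 : ℝ))),
    z t = mv G.Go.Cz (x t) + mv G.Go.Dzw (w t) + mv G.Go.Dzu (u t) + mv G.Go.Dzr (r t)
  y_eq : ∀ᵐ t ∂(volume.restrict (Ici (0 : ℝ))),
    y t = mv G.Go.Cy (x t) + mv G.Go.Dyw (w t) + mv G.Go.Dyu (u t) + mv G.Go.Dyr (r t)
  v_eq : ∀ᵐ t ∂(volume.restrict (Ici (0 : ℝ))),
    v t = mv G.Go.Cv (x t) + mv G.Go.Dvw (w t) + mv G.Go.Dvu (u t)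
  f_eq : ∀ᵐ t ∂(volume.restrict (Ici (0 : ℝ))),
    HasDerivAt (fun τ => (f τ).state) (toL2 a b (G.Gp.rhs (f t) (v t))) t
  r_eq : ∀ᵐ t ∂(volume.restrict (Ici (0 : ℝ))), r t = G.Gp.out (f t)

/-- Strong solutions: in addition `x` and `x̂` are locally absolutely continuous in time with
values in `ℝ^nx` and `L₂`, and `x̂` is locally square integrable in time with values in `Wⁿ`. -/
structure IsStrongSolution (G : Model a b n nBC nx nw nu nr nz ny nv)
    (x0 : Vec (Fin nx)) (f0 : Sob a b n) (w : ℝ → Vec (Fin nw)) (u : ℝ → Vec (Fin nu))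
    (x : ℝ → Vec (Fin nx)) (f : ℝ → Sob a b n) (z : ℝ → Vec (Fin nz)) (y : ℝ → Vec (Fin ny))
    (v : ℝ → Vec (Fin nv)) (r : ℝ → Vec (Fin nr)) : Prop
    extends IsSolution G x0 f0 w u x f z y v r where
  x_ac : LocAC x
  f_ac : LocAC fun t => (f t).state
  f_mem : L2e fun t => (f t).jet

/-- The norm of `{x, x̂}` in `ℝ^nx × Wⁿ`:
`‖{x, x̂}‖² = ‖x‖² + ∑ᵢ ∑_{j ≤ i} ‖∂ₛʲ x̂ᵢ‖²_{L₂}`. -/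
def sobNorm (x : Vec (Fin nx)) (f : Sob a b n) : ℝ :=
  ‖(WithLp.toLp 2 (x, f.jet) : RL2 a b (Fin nx) (FIdx n))‖

/-- Exponential stability of a GPDE model in the `ℝ^nx × Wⁿ` norm. -/
def ExpStable (G : Model a b n nBC nx nw nu nr nz ny nv) : Prop :=
  ∃ M α : ℝ, 0 < M ∧ 0 < α ∧ ∀ (x0 : Vec (Fin nx)) (f0 : Sob a b n), G.InDomain 0 0 x0 f0 →
    ∀ (x : ℝ → Vec (Fin nx)) (f : ℝ → Sob a b n) (z : ℝ → Vec (Fin nz))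
      (y : ℝ → Vec (Fin ny)) (v : ℝ → Vec (Fin nv)) (r : ℝ → Vec (Fin nr)),
      G.IsSolution x0 f0 0 0 x f z y v r →
        ∀ t : ℝ, 0 ≤ t → sobNorm (x t) (f t) ≤ M * sobNorm x0 f0 * Real.exp (-α * t)

/-- Exponential stability of a GPDE model in the `ℝ^nx × Wⁿ` norm, for strong solutions. -/
def ExpStableStrong (G : Model a b n nBC nx nw nu nr nz ny nv) : Prop :=
  ∃ M α : ℝ, 0 < M ∧ 0 < α ∧ ∀ (x0 : Vec (Fin nx)) (f0 : Sob a b n), G.InDomain 0 0 x0 f0 →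
    ∀ (x : ℝ → Vec (Fin nx)) (f : ℝ → Sob a b n) (z : ℝ → Vec (Fin nz))
      (y : ℝ → Vec (Fin ny)) (v : ℝ → Vec (Fin nv)) (r : ℝ → Vec (Fin nr)),
      G.IsStrongSolution x0 f0 0 0 x f z y v r →
        ∀ t : ℝ, 0 ≤ t → sobNorm (x t) (f t) ≤ M * sobNorm x0 f0 * Real.exp (-α * t)

end Model

/-! ### Admissibility and the associated PIE -/

/-- `τᵢ(s) = sⁱ / i!`. -/
def tau (i : ℕ) (s : ℝ) : ℝ := s ^ i / (i.factorial : ℝ)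

section Blocks

variable {N : ℕ} (n : Fin (N + 1) → ℕ)

/-- `T(s)`: maps `(C x̂)(a)` to its Taylor contribution to `(C x̂)(a + s)`. -/
def Tmat (s : ℝ) : Matrix (CIdx n) (CIdx n) ℝ := Matrix.of fun c d =>
  if c.1 = d.1 ∧ (c.2 : ℕ) ≤ (d.2 : ℕ) then tau ((d.2 : ℕ) - (c.2 : ℕ)) s else 0

/-- `Q(s)`: the entry with row `∂ₛʲ x̂_x` and column `x` of `x̂ᵢ` is `τ_{i-1-j}(s)`. -/
def Qmat (s : ℝ) : Matrix (CIdx n) (XIdx n) ℝ := Matrix.of fun c x =>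
  if c.1 = x then tau ((x.1 : ℕ) - 1 - (c.2 : ℕ)) s else 0

/-- `[0; T₁(s)]`: the rows of `T(s)` of derivative order zero, preceded by zero rows for `x̂₀`. -/
def T1mat (s : ℝ) : Matrix (XIdx n) (CIdx n) ℝ := Matrix.of fun x d =>
  if x = d.1 then tau (d.2 : ℕ) s else 0

/-- `[0; Q₁(s)]`: the rows of `Q(s)` of derivative order zero, preceded by zero rows for `x̂₀`. -/
def Q1mat (s : ℝ) : Matrix (XIdx n) (XIdx n) ℝ := Matrix.of fun x x' =>
  if x = x' ∧ 0 < (x.1 : ℕ) then tau ((x.1 : ℕ) - 1) s else 0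

/-- `U₁` selects the highest derivatives in `F x̂`. -/
def U1mat : Matrix (FIdx n) (XIdx n) ℝ := Matrix.of fun f x =>
  if f.1 = x ∧ (f.2 : ℕ) = (x.1 : ℕ) then 1 else 0

/-- `U₂` selects the entries of `C x̂` in `F x̂`. -/
def U2mat : Matrix (FIdx n) (CIdx n) ℝ := Matrix.of fun f c =>
  if f.1 = c.1 ∧ (f.2 : ℕ) = (c.2 : ℕ) then 1 else 0

/-- `G₀ = diag(I_{n₀}, 0)`. -/
def G0mat : Matrix (XIdx n) (XIdx n) ℝ := Matrix.of fun x x' =>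
  if x = x' ∧ (x.1 : ℕ) = 0 then 1 else 0

end Blocks

namespace BCParam

variable {N : ℕ} {a b : ℝ} {n : Fin (N + 1) → ℕ} {nBC nv : ℕ} (Gb : BCParam a b n nBC nv)

/-- `B_T = B [T(0); T(b-a)] - ∫ₐᵇ B_I(s) U₂ T(s-a) ds`. -/
def BT : Matrix (Fin nBC) (CIdx n) ℝ :=
  Gb.B * Matrix.fromRows (Tmat n 0) (Tmat n (b - a))
    - matInt a b fun s => Gb.BI s * U2mat n * Tmat n (s - a)

/-- `{n, G_b}` is admissible if `B_T` is invertible (in particular square). -/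
def Admissible : Prop := IsInvertible Gb.BT

/-- `B_Q(s) = B_T⁻¹ (B_I(s) U₁ + ∫ₛᵇ B_I(θ) U₂ Q(θ-s) dθ - B [0; Q(b-s)])`. -/
def BQ (s : ℝ) : Matrix (CIdx n) (XIdx n) ℝ :=
  matInv Gb.BT * (Gb.BI s * U1mat n
    + (matInt s b fun θ => Gb.BI θ * U2mat n * Qmat n (θ - s))
    - Gb.B * Matrix.fromRows (0 : Matrix (CIdx n) (XIdx n) ℝ) (Qmat n (b - s)))

/-- `G_v(s) = [0; T₁(s-a) B_T⁻¹ B_v]`. -/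
def Gv (s : ℝ) : Matrix (XIdx n) (Fin nv) ℝ := T1mat n (s - a) * (matInv Gb.BT * Gb.Bv)

/-- `G₂(s,θ) = [0; T₁(s-a) B_Q(θ)]`. -/
def G2 (s θ : ℝ) : Matrix (XIdx n) (XIdx n) ℝ := T1mat n (s - a) * Gb.BQ θ

/-- `G₁(s,θ) = [0; Q₁(s-θ)] + G₂(s,θ)`. -/
def G1 (s θ : ℝ) : Matrix (XIdx n) (XIdx n) ℝ := Q1mat n (s - θ) + Gb.G2 s θ

/-- `R_{D,2}(s,θ) = U₂ T(s-a) B_Q(θ)`. -/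
def RD2 (s θ : ℝ) : Matrix (FIdx n) (XIdx n) ℝ := U2mat n * Tmat n (s - a) * Gb.BQ θ

/-- `R_{D,1}(s,θ) = R_{D,2}(s,θ) + U₂ Q(s-θ)`. -/
def RD1 (s θ : ℝ) : Matrix (FIdx n) (XIdx n) ℝ := Gb.RD2 s θ + U2mat n * Qmat n (s - θ)

/-- The parameters `Υ`, of the operator taking `(v, D x̂)` to `((v, B x̂), F x̂)`. -/
def Upsilon : PIParam (Fin nv ⊕ BIdx n) (FIdx n) (Fin nv) (XIdx n) where
  P := Matrix.fromRows 1 (Matrix.fromRows (matInv Gb.BT * Gb.Bv)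
    (Tmat n (b - a) * (matInv Gb.BT * Gb.Bv)))
  Q1 := fun s => Matrix.fromRows 0 (Matrix.fromRows (Gb.BQ s)
    (Tmat n (b - a) * Gb.BQ s + Qmat n (b - s)))
  Q2 := fun s => U2mat n * Tmat n (s - a) * (matInv Gb.BT * Gb.Bv)
  R0 := fun _ => U1mat n
  R1 := Gb.RD1
  R2 := Gb.RD2

end BCParam

/-- The parameters `Ξ`, of the operator taking `((v, B x̂), F x̂)` to `(r, ∂ₜ x̂)`. -/
def PDEParam.Xi {N : ℕ} {a b : ℝ} {n : Fin (N + 1) → ℕ} {nv nr : ℕ}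
    (Gp : PDEParam a b n nv nr) :
    PIParam (Fin nr) (XIdx n) (Fin nv ⊕ BIdx n) (FIdx n) where
  P := Matrix.fromCols 0 Gp.Drb
  Q1 := Gp.Cr
  Q2 := fun s => Matrix.fromCols (Gp.Bxv s) (Gp.Bxb s)
  R0 := Gp.A0
  R1 := Gp.A1
  R2 := Gp.A2

namespace Model

variable {N : ℕ} {a b : ℝ} {n : Fin (N + 1) → ℕ} {nBC nx nw nu nr nz ny nv : ℕ}

/-- The parameters `[D_rv, C_rx; B_xv, {Âᵢ}]` of the PIE subsystem, obtained by composing the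
parameters `Ξ` and `Υ`. -/
def sub (G : Model a b n nBC nx nw nu nr nz ny nv) :
    PIParam (Fin nr) (XIdx n) (Fin nv) (XIdx n) :=
  PIParam.comp a b G.Gp.Xi G.Gb.Upsilon

/-- The PIE system associated with a GPDE model. -/
def toPIE (G : Model a b n nBC nx nw nu nr nz ny nv) :
    PIESystem nx (XIdx n) nw nu nz ny where
  T :=
    { P := 1
      Q1 := fun _ => 0
      Q2 := fun s => G.Gb.Gv s * G.Go.Cv
      R0 := fun _ => G0mat n
      R1 := G.Gb.G1
      R2 := G.Gb.G2 }
  Tw :=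
    { P := 0
      Q1 := fun _ => 0
      Q2 := fun s => G.Gb.Gv s * G.Go.Dvw
      R0 := fun _ => 0
      R1 := fun _ _ => 0
      R2 := fun _ _ => 0 }
  Tu :=
    { P := 0
      Q1 := fun _ => 0
      Q2 := fun s => G.Gb.Gv s * G.Go.Dvu
      R0 := fun _ => 0
      R1 := fun _ _ => 0
      R2 := fun _ _ => 0 }
  A :=
    { P := G.Go.A + G.Go.Bxr * G.sub.P * G.Go.Cv
      Q1 := fun s => G.Go.Bxr * G.sub.Q1 s
      Q2 := fun s => G.sub.Q2 s * G.Go.Cv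
      R0 := G.sub.R0
      R1 := G.sub.R1
      R2 := G.sub.R2 }
  B1 :=
    { P := G.Go.Bxw + G.Go.Bxr * G.sub.P * G.Go.Dvw
      Q1 := fun _ => 0
      Q2 := fun s => G.sub.Q2 s * G.Go.Dvw
      R0 := fun _ => 0
      R1 := fun _ _ => 0
      R2 := fun _ _ => 0 }
  B2 :=
    { P := G.Go.Bxu + G.Go.Bxr * G.sub.P * G.Go.Dvu
      Q1 := fun _ => 0
      Q2 := fun s => G.sub.Q2 s * G.Go.Dvu
      R0 := fun _ => 0
      R1 := fun _ _ => 0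
      R2 := fun _ _ => 0 }
  C1 :=
    { P := G.Go.Cz + G.Go.Dzr * G.sub.P * G.Go.Cv
      Q1 := fun s => G.Go.Dzr * G.sub.Q1 s
      Q2 := fun _ => 0
      R0 := fun _ => 0
      R1 := fun _ _ => 0
      R2 := fun _ _ => 0 }
  C2 :=
    { P := G.Go.Cy + G.Go.Dyr * G.sub.P * G.Go.Cv
      Q1 := fun s => G.Go.Dyr * G.sub.Q1 s
      Q2 := fun _ => 0
      R0 := fun _ => 0
      R1 := fun _ _ => 0
      R2 := fun _ _ => 0 }
  D11 :=
    { P := G.Go.Dzw + G.Go.Dzr * G.sub.P * G.Go.Dvw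
      Q1 := fun _ => 0
      Q2 := fun _ => 0
      R0 := fun _ => 0
      R1 := fun _ _ => 0
      R2 := fun _ _ => 0 }
  D12 :=
    { P := G.Go.Dzu + G.Go.Dzr * G.sub.P * G.Go.Dvu
      Q1 := fun _ => 0
      Q2 := fun _ => 0
      R0 := fun _ => 0
      R1 := fun _ _ => 0
      R2 := fun _ _ => 0 }
  D21 :=
    { P := G.Go.Dyw + G.Go.Dyr * G.sub.P * G.Go.Dvw
      Q1 := fun _ => 0
      Q2 := fun _ => 0
      R0 := fun _ => 0
      R1 := fun _ _ => 0
      R2 := fun _ _ => 0 }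
  D22 :=
    { P := G.Go.Dyu + G.Go.Dyr * G.sub.P * G.Go.Dvu
      Q1 := fun _ => 0
      Q2 := fun _ => 0
      R0 := fun _ => 0
      R1 := fun _ _ => 0
      R2 := fun _ _ => 0 }

end Model

end GPDE

end

noncomputable section

namespace GPDE

/-! ### Matrix-vector products -/

section MatrixVector

variable {m n p : Type} [Fintype n]

/-! An element `x̂` of `Wⁿ` is determined by its left boundary values `c = (C x̂)(a)` and its
highest derivatives `V = D x̂`, through Taylor's formula with integral remainder; conversely every
pair `(c, V)` with `V` in `L₂` occurs. Inserting Taylor's formula into the boundary conditions and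
exchanging the order of integration turns them into a linear system for `c`, namely `B_T c = B_v v +
∫ B_T B_Q V`. Admissibility makes it uniquely solvable, so the elements of `𝒳_v` correspond
bijectively to `V ∈ L₂`, without constraints on `V` (`holds_ofData_iff_eq`, `Holds.eq_recon`).

This reconstruction `(v, V) ↦ x̂` is exactly what the PI operators encode. The distributed part of
`𝒯` is `x̂` itself (`state_recon`), `𝒫[Υ]` yields `F x̂` and the boundary values (`recon_F`,
`elim_bdry_recon`), and `𝒫[Ξ] 𝒫[Υ]` yields the output `r` and the right-hand side of the PDE
(`finPart_comp`, `distPart_comp`). With zero inputs `v = C_v x`, so `(x, x̂) ↦ (x, D x̂)` carries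
GPDE solutions to PIE solutions, and reconstruction goes back.

Both passages are bounded: `D x̂` is a component of `F x̂`, and `F x̂` depends continuously on `(x,
D x̂)` because Volterra integrals with polynomial kernels are bounded. Hence the Sobolev norm of
`(x, x̂)` and the `ℝL₂` norm of `(x, D x̂)` are equivalent on the domain, and an exponential
estimate passes over with the same rate and a larger constant.

One gap remains for general solutions: a PIE solution need not be square integrable in time, whereas
a GPDE solution must have `v` and `r` in `L_{2e}`. The estimate at time `T` involves only the states
at `0` and `T`, and the equations hold only at almost every time, so the state may be replaced by
zero at all other times (`PIESystem.IsSolution.truncate`). Strong solutions are square integrable by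
definition and need no such change. -/

lemma mv_apply (M : Matrix m n ℝ) (x : Vec n) (i : m) : mv M x i = ∑ j, M i j * x j := rfl

lemma mv_add (M : Matrix m n ℝ) (x y : Vec n) : mv M (x + y) = mv M x + mv M y := by
  ext i; simp [mv, Matrix.mulVec_add]

lemma mv_smul (M : Matrix m n ℝ) (c : ℝ) (x : Vec n) : mv M (c • x) = c • mv M x := by
  ext i; simp [mv, Matrix.mulVec_smul]

@[simp] lemma mv_zero (M : Matrix m n ℝ) : mv M (0 : Vec n) = 0 := by
  ext i; simp [mv]

lemma add_mv (M M' : Matrix m n ℝ) (x : Vec n) : mv (M + M') x = mv M x + mv M' x := by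
  ext i; simp [mv, Matrix.add_mulVec]

lemma sub_mv (M M' : Matrix m n ℝ) (x : Vec n) : mv (M - M') x = mv M x - mv M' x := by
  ext i; simp [mv, Matrix.sub_mulVec]

@[simp] lemma zero_mv (x : Vec n) : mv (0 : Matrix m n ℝ) x = 0 := by
  ext i; simp [mv]

@[simp] lemma one_mv [DecidableEq n] (x : Vec n) : mv (1 : Matrix n n ℝ) x = x := by
  ext i; simp [mv]

lemma mul_mv [Fintype p] (M : Matrix m n ℝ) (M' : Matrix n p ℝ) (x : Vec p) :
    mv (M * M') x = mv M (mv M' x) := by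
  ext i; simp [mv, Matrix.mulVec_mulVec]

/-- `mv M` as a continuous linear map. -/
def mvL [Fintype m] (M : Matrix m n ℝ) : Vec n →L[ℝ] Vec m :=
  LinearMap.toContinuousLinearMap
    { toFun := mv M
      map_add' := mv_add M
      map_smul' := mv_smul M }

@[simp] lemma mvL_apply [Fintype m] (M : Matrix m n ℝ) (x : Vec n) : mvL M x = mv M x := rfl

end MatrixVector

/-! ### Componentwise integrals -/

/-- Componentwise interval integral of a vector-valued function. -/
def intV {p : Type} (a b : ℝ) (g : ℝ → Vec p) : Vec p :=
  WithLp.toLp 2 fun i => ∫ θ in a..b, g θ i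

lemma intV_apply {p : Type} (a b : ℝ) (g : ℝ → Vec p) (i : p) :
    intV a b g i = ∫ θ in a..b, g θ i := rfl

lemma integral_eq_vol {E : Type} [NormedAddCommGroup E] [NormedSpace ℝ E] {a b : ℝ} (hab : a ≤ b)
    (f : ℝ → E) : ∫ s in a..b, f s = ∫ s, f s ∂(vol a b) := by
  rw [intervalIntegral.integral_of_le hab, integral_Icc_eq_integral_Ioc]

lemma intV_congr {p : Type} {a b : ℝ} (hab : a ≤ b) {f g : ℝ → Vec p} (h : f =ᵐ[vol a b] g) :
    intV a b f = intV a b g := by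
  ext i
  rw [intV_apply, intV_apply, integral_eq_vol hab, integral_eq_vol hab]
  exact integral_congr_ae (h.mono fun s hs => by simp [hs])

lemma intV_congr_Icc {p : Type} {a b : ℝ} (hab : a ≤ b) {f g : ℝ → Vec p}
    (h : ∀ s ∈ Icc a b, f s = g s) : intV a b f = intV a b g :=
  intV_congr hab ((ae_restrict_iff' measurableSet_Icc).2 (Filter.Eventually.of_forall h))

lemma vol_le_left {a b s : ℝ} (hs : s ∈ Icc a b) : vol a s ≤ vol a b :=
  Measure.restrict_mono (Icc_subset_Icc le_rfl hs.2) le_rfl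

lemma vol_le_right {a b s : ℝ} (hs : s ∈ Icc a b) : vol s b ≤ vol a b :=
  Measure.restrict_mono (Icc_subset_Icc hs.1 le_rfl) le_rfl

lemma intervalIntegrable_of_vol {E : Type} [NormedAddCommGroup E] {a b : ℝ} (hab : a ≤ b)
    {f : ℝ → E} (hf : Integrable f (vol a b)) : IntervalIntegrable f volume a b :=
  (intervalIntegrable_iff_integrableOn_Icc_of_le hab).2 hf

lemma intV_add {p : Type} {a b : ℝ} (hab : a ≤ b) {f g : ℝ → Vec p}
    (hf : ∀ i, Integrable (fun s => f s i) (vol a b))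
    (hg : ∀ i, Integrable (fun s => g s i) (vol a b)) :
    intV a b (fun s => f s + g s) = intV a b f + intV a b g := by
  ext i
  simp only [intV_apply, PiLp.add_apply]
  exact intervalIntegral.integral_add (intervalIntegrable_of_vol hab (hf i))
    (intervalIntegrable_of_vol hab (hg i))

lemma intV_sub {p : Type} {a b : ℝ} (hab : a ≤ b) {f g : ℝ → Vec p}
    (hf : ∀ i, Integrable (fun s => f s i) (vol a b))
    (hg : ∀ i, Integrable (fun s => g s i) (vol a b)) :
    intV a b (fun s => f s - g s) = intV a b f - intV a b g := by
  ext i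
  simp only [intV_apply, PiLp.sub_apply]
  exact intervalIntegral.integral_sub (intervalIntegrable_of_vol hab (hf i))
    (intervalIntegrable_of_vol hab (hg i))

lemma intV_split {p : Type} {a b s : ℝ} (hs : s ∈ Icc a b) {f : ℝ → Vec p}
    (hf : ∀ i, Integrable (fun s => f s i) (vol a b)) :
    intV a s f + intV s b f = intV a b f := by
  ext i
  exact intervalIntegral.integral_add_adjacent_intervals
    (intervalIntegrable_of_vol hs.1 ((hf i).mono_measure (vol_le_left hs)))
    (intervalIntegrable_of_vol hs.2 ((hf i).mono_measure (vol_le_right hs)))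

lemma mv_intV {m p : Type} [Fintype p] {a b : ℝ} (hab : a ≤ b) (M : Matrix m p ℝ) {f : ℝ → Vec p}
    (hf : ∀ i, Integrable (fun s => f s i) (vol a b)) :
    mv M (intV a b f) = intV a b fun s => mv M (f s) := by
  ext i
  simp only [intV_apply, mv_apply]
  rw [intervalIntegral.integral_finsetSum
    fun j _ => (intervalIntegrable_of_vol hab (hf j)).const_mul _]
  simp

lemma mv_matInt {m p : Type} [Fintype p] {a b : ℝ} (hab : a ≤ b) {M : ℝ → Matrix m p ℝ}
    (hM : ∀ i j, Integrable (fun s => M s i j) (vol a b)) (x : Vec p) :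
    mv (matInt a b M) x = intV a b fun s => mv (M s) x := by
  ext i
  simp only [intV_apply, mv_apply, matInt, Matrix.of_apply]
  rw [intervalIntegral.integral_finsetSum
    fun j _ => (intervalIntegrable_of_vol hab (hM i j)).mul_const _]
  simp

/-- Open intervals suffice, and are needed: a kernel glued from two pieces along `θ < s` agrees with
the first piece only strictly to the left of `s`. -/
lemma matInt_congr_Ioo {m p : Type} {a b : ℝ} (hab : a ≤ b) {f g : ℝ → Matrix m p ℝ}
    (h : ∀ s ∈ Ioo a b, f s = g s) : matInt a b f = matInt a b g := by
  ext i j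
  simp only [matInt, Matrix.of_apply, intervalIntegral.integral_of_le hab,
    integral_Ioc_eq_integral_Ioo]
  exact setIntegral_congr_fun measurableSet_Ioo fun s hs => by simp [h s hs]

lemma matInt_split {m p : Type} {a b s : ℝ} (hs : s ∈ Icc a b) {f : ℝ → Matrix m p ℝ}
    (hf : ∀ i j, Integrable (fun s => f s i j) (vol a b)) :
    matInt a s f + matInt s b f = matInt a b f := by
  ext i j
  exact intervalIntegral.integral_add_adjacent_intervals
    (intervalIntegrable_of_vol hs.1 ((hf i j).mono_measure (vol_le_left hs)))
    (intervalIntegrable_of_vol hs.2 ((hf i j).mono_measure (vol_le_right hs)))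

lemma matInt_add {m p : Type} {a b : ℝ} (hab : a ≤ b) {f g : ℝ → Matrix m p ℝ}
    (hf : ∀ i j, Integrable (fun s => f s i j) (vol a b))
    (hg : ∀ i j, Integrable (fun s => g s i j) (vol a b)) :
    matInt a b (fun s => f s + g s) = matInt a b f + matInt a b g := by
  ext i j
  exact intervalIntegral.integral_add (intervalIntegrable_of_vol hab (hf i j))
    (intervalIntegrable_of_vol hab (hg i j))

lemma matInt_mul_const {m p q : Type} [Fintype p] {a b : ℝ} (hab : a ≤ b) {f : ℝ → Matrix m p ℝ}
    (hf : ∀ i j, Integrable (fun s => f s i j) (vol a b)) (C : Matrix p q ℝ) :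
    matInt a b (fun s => f s * C) = matInt a b f * C := by
  ext i j
  simp only [matInt, Matrix.of_apply, Matrix.mul_apply]
  rw [intervalIntegral.integral_finsetSum
    fun k _ => (intervalIntegrable_of_vol hab (hf i k)).mul_const _]
  simp

/-! ### Square integrable matrix functions -/

namespace MemL2Mat

variable {m n p : Type} {a b : ℝ}

lemma integrable {M : ℝ → Matrix m n ℝ} (hM : MemL2Mat a b M) (i : m) (j : n) :
    Integrable (fun s => M s i j) (vol a b) := (hM i j).integrable (by norm_num)

lemma add {M M' : ℝ → Matrix m n ℝ} (hM : MemL2Mat a b M) (hM' : MemL2Mat a b M') :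
    MemL2Mat a b fun s => M s + M' s := fun i j => (hM i j).add (hM' i j)

lemma sub {M M' : ℝ → Matrix m n ℝ} (hM : MemL2Mat a b M) (hM' : MemL2Mat a b M') :
    MemL2Mat a b fun s => M s - M' s := fun i j => (hM i j).sub (hM' i j)

lemma const_mul [Fintype n] (C : Matrix m n ℝ) {M : ℝ → Matrix n p ℝ} (hM : MemL2Mat a b M) :
    MemL2Mat a b fun s => C * M s := fun i j => by
  simp only [Matrix.mul_apply]
  exact memLp_finsetSum _ fun k _ => (hM k j).const_mul _

lemma mul_linf [Fintype n] {M : ℝ → Matrix m n ℝ} {M' : ℝ → Matrix n p ℝ} (hM : MemL2Mat a b M)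
    (hM' : MemLinfMat a b M') : MemL2Mat a b fun s => M s * M' s := fun i j => by
  simp only [Matrix.mul_apply]
  exact memLp_finsetSum _ fun k _ => (hM' k j).mul' (p := 2) (q := ⊤) (r := 2) (hM i k)

lemma of_linf {M : ℝ → Matrix m n ℝ} (hM : MemLinfMat a b M) : MemL2Mat a b M :=
  fun i j => (hM i j).mono_exponent le_top

lemma congr_Icc {M M' : ℝ → Matrix m n ℝ} (hM : MemL2Mat a b M) (h : ∀ s ∈ Icc a b, M s = M' s) :
    MemL2Mat a b M' := fun i j =>
  (memLp_congr_ae ((ae_restrict_iff' measurableSet_Icc).2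
    (Filter.Eventually.of_forall fun s hs => by simp [h s hs]))).1 (hM i j)

/-- Serves to merge the two kernels of a PI operator, one for each side of the diagonal, into one
kernel on `[a, b]`. -/
lemma ite_lt {M M' : ℝ → Matrix m n ℝ} (hM : MemL2Mat a b M) (hM' : MemL2Mat a b M') (s : ℝ) :
    MemL2Mat a b fun η => if η < s then M η else M' η := fun i j => by
  have h := MemLp.piecewise (s := Iio s) measurableSet_Iio ((hM i j).restrict _)
    ((hM' i j).restrict _)
  refine (memLp_congr_ae (Filter.Eventually.of_forall fun η => ?_)).1 h
  by_cases hη : η < s <;> simp [Set.piecewise, hη]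

lemma mv_integrable [Fintype n] {M : ℝ → Matrix m n ℝ} (hM : MemL2Mat a b M) {v : ℝ → Vec n}
    (hv : MemLp v 2 (vol a b)) (i : m) : Integrable (fun s => mv (M s) (v s) i) (vol a b) := by
  simp only [mv_apply]
  exact integrable_finsetSum _ fun j _ => (hM i j).integrable_mul (hv.eval_piLp j)

end MemL2Mat

lemma MemLinfMat.of_continuous {m n : Type} (a b : ℝ) {M : ℝ → Matrix m n ℝ}
    (hM : ∀ i j, Continuous fun s => M s i j) : MemLinfMat a b M := fun i j => by
  obtain ⟨C, hC⟩ := isCompact_Icc.exists_bound_of_continuousOn (hM i j).continuousOn (s := Icc a b)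
  exact MemLp.of_bound (hM i j).aestronglyMeasurable C
    ((ae_restrict_iff' measurableSet_Icc).2 (Filter.Eventually.of_forall hC))

/-! ### Volterra integrals -/

section Volterra

variable {a b : ℝ}

/-- The variable endpoint becomes a cutoff under an integral over the fixed interval, the form to
which Fubini's theorem applies. The strict inequality drops only a null set. -/
lemma integral_cut_left {η : ℝ} (hη : η ∈ Icc a b) (g : ℝ → ℝ) :
    ∫ θ in a..η, g θ = ∫ θ, (if θ < η then g θ else 0) ∂(vol a b) := by
  have h : (fun θ => if θ < η then g θ else 0) = (Iio η).indicator g := by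
    ext θ; simp [indicator]
  rw [h, integral_indicator measurableSet_Iio, Measure.restrict_restrict measurableSet_Iio,
    intervalIntegral.integral_of_le hη.1, integral_Ioc_eq_integral_Ioo,
    ← integral_Ico_eq_integral_Ioo]
  congr 2
  ext θ
  simp only [mem_Ico, mem_inter_iff, mem_Iio, mem_Icc]
  exact ⟨fun h => ⟨h.2, h.1, h.2.le.trans hη.2⟩, fun h => ⟨h.2.1, h.1⟩⟩

lemma integral_cut_right {θ : ℝ} (hθ : θ ∈ Icc a b) (g : ℝ → ℝ) :
    ∫ η in θ..b, g η = ∫ η, (if θ < η then g η else 0) ∂(vol a b) := by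
  have h : (fun η => if θ < η then g η else 0) = (Ioi θ).indicator g := by
    ext θ; simp [indicator]
  rw [h, integral_indicator measurableSet_Ioi, Measure.restrict_restrict measurableSet_Ioi,
    intervalIntegral.integral_of_le hθ.2]
  congr 2
  ext η
  simp only [mem_Ioc, mem_inter_iff, mem_Ioi, mem_Icc]
  exact ⟨fun h => ⟨h.1, hθ.1.trans h.1.le, h.2⟩, fun h => ⟨h.1, h.2.2⟩⟩

/-- Differences of points of `[a, b]` stay in the compact interval `[a - b, b - a]`. -/
lemma exists_bound_sub (a b : ℝ) {φ : ℝ → ℝ} (hφ : Continuous φ) :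
    ∃ C, 0 ≤ C ∧ ∀ η ∈ Icc a b, ∀ θ ∈ Icc a b, |φ (η - θ)| ≤ C := by
  obtain ⟨C, hC⟩ := (isCompact_Icc (a := a - b) (b := b - a)).exists_bound_of_continuousOn
    hφ.continuousOn
  refine ⟨max C 0, le_max_right _ _, fun η hη θ hθ => (hC _ ?_).trans (le_max_left _ _)⟩
  constructor <;> linarith [hη.1, hη.2, hθ.1, hθ.2]

lemma ae_prod_mem_Icc (a b : ℝ) :
    ∀ᵐ p ∂((vol a b).prod (vol a b)), p.1 ∈ Icc a b ∧ p.2 ∈ Icc a b := by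
  rw [Measure.prod_restrict]
  exact (ae_restrict_mem (measurableSet_Icc.prod measurableSet_Icc)).mono fun p hp => hp

/-- The tensor product of `k` and `v` is integrable on the square; the factor `φ (η - θ)` is bounded
there, and cutting down to the triangle `θ < η` preserves integrability. -/
lemma volterra_integrable {k v φ : ℝ → ℝ} (hk : Integrable k (vol a b))
    (hv : Integrable v (vol a b)) (hφ : Continuous φ) :
    Integrable (fun p : ℝ × ℝ => if p.2 < p.1 then k p.1 * φ (p.1 - p.2) * v p.2 else 0)
      ((vol a b).prod (vol a b)) := by
  obtain ⟨C, -, hC⟩ := exists_bound_sub a b hφ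
  have hkv := hk.mul_prod hv
  have h : (fun p : ℝ × ℝ => if p.2 < p.1 then k p.1 * φ (p.1 - p.2) * v p.2 else 0)
      = {p : ℝ × ℝ | p.2 < p.1}.indicator fun p => φ (p.1 - p.2) * (k p.1 * v p.2) := by
    ext p; simp only [indicator, mem_ofPred_eq]; congr 1; ring
  rw [h]
  refine Integrable.indicator ?_ (measurableSet_lt measurable_snd measurable_fst)
  refine hkv.bdd_mul (c := C) (by fun_prop) ((ae_prod_mem_Icc a b).mono fun p hp => ?_)
  exact hC _ hp.1 _ hp.2

/-- Both sides are iterated integrals of one integrable function on the triangle `θ < η`. All kernel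
identities below rest on this exchange. -/
lemma integral_volterra_swap (hab : a ≤ b) {k v φ : ℝ → ℝ} (hk : Integrable k (vol a b))
    (hv : Integrable v (vol a b)) (hφ : Continuous φ) :
    ∫ η in a..b, k η * ∫ θ in a..η, φ (η - θ) * v θ
      = ∫ θ in a..b, (∫ η in θ..b, k η * φ (η - θ)) * v θ := by
  have hl : ∫ η in a..b, k η * ∫ θ in a..η, φ (η - θ) * v θ
      = ∫ η, ∫ θ, (if θ < η then k η * φ (η - θ) * v θ else 0) ∂(vol a b) ∂(vol a b) := by
    rw [integral_eq_vol hab]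
    refine setIntegral_congr_fun measurableSet_Icc fun η hη => ?_
    simp only [← intervalIntegral.integral_const_mul]
    rw [integral_cut_left hη]
    congr 1; ext θ; rw [mul_assoc]
  have hr : ∫ θ in a..b, (∫ η in θ..b, k η * φ (η - θ)) * v θ
      = ∫ θ, ∫ η, (if θ < η then k η * φ (η - θ) * v θ else 0) ∂(vol a b) ∂(vol a b) := by
    rw [integral_eq_vol hab]
    refine setIntegral_congr_fun measurableSet_Icc fun θ hθ => ?_
    simp only [← intervalIntegral.integral_mul_const]
    rw [integral_cut_right hθ]
  rw [hl, hr]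
  exact integral_integral_swap (volterra_integrable hk hv hφ)

/-- The constant depends on `φ` only, not on `v`; this uniformity later gives continuity of the
reconstruction. -/
lemma exists_volterra_bound (a b : ℝ) {φ : ℝ → ℝ} (hφ : Continuous φ) :
    ∃ C, 0 ≤ C ∧ ∀ v : ℝ → ℝ, Integrable v (vol a b) → ∀ η ∈ Icc a b,
      |∫ θ in a..η, φ (η - θ) * v θ| ≤ C * ∫ θ, |v θ| ∂(vol a b) := by
  obtain ⟨C, hC0, hC⟩ := exists_bound_sub a b hφ
  refine ⟨C, hC0, fun v hv η hη => ?_⟩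
  rw [integral_cut_left hη, ← integral_const_mul, ← Real.norm_eq_abs]
  refine (norm_integral_le_integral_norm _).trans
    (integral_mono_of_nonneg (Filter.Eventually.of_forall fun _ => norm_nonneg _)
      (hv.abs.const_mul _) ?_)
  refine (ae_restrict_iff' measurableSet_Icc).2 (Filter.Eventually.of_forall fun θ hθ => ?_)
  dsimp only
  split_ifs with h
  · rw [norm_mul]; exact mul_le_mul_of_nonneg_right (hC _ hη _ hθ) (abs_nonneg _)
  · rw [norm_zero]; positivity

/-- Boundedness is the previous estimate. Measurability comes from seeing the function as a partial
integral of an integrable function on the square, with `k = 1`. -/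
lemma memLp_volterra {v φ : ℝ → ℝ} (hv : Integrable v (vol a b)) (hφ : Continuous φ) :
    MemLp (fun η => ∫ θ in a..η, φ (η - θ) * v θ) ⊤ (vol a b) := by
  obtain ⟨C, -, hC⟩ := exists_volterra_bound a b hφ
  refine MemLp.of_bound ?_ (C * ∫ θ, |v θ| ∂(vol a b))
    ((ae_restrict_iff' measurableSet_Icc).2 (Filter.Eventually.of_forall fun η hη => hC v hv η hη))
  refine (volterra_integrable (integrable_const (1 : ℝ)) hv
    hφ).aestronglyMeasurable.integral_prod_right'.congr
    ((ae_restrict_iff' measurableSet_Icc).2 (Filter.Eventually.of_forall fun η hη => ?_))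
  dsimp only
  rw [integral_cut_left hη]
  simp only [one_mul]

lemma memLp_volterra_adjoint {k φ : ℝ → ℝ} (hk : Integrable k (vol a b)) (hφ : Continuous φ) :
    MemLp (fun θ => ∫ η in θ..b, k η * φ (η - θ)) ⊤ (vol a b) := by
  obtain ⟨C, hC0, hC⟩ := exists_bound_sub a b hφ
  refine MemLp.of_bound ?_ (∫ η, C * |k η| ∂(vol a b))
    ((ae_restrict_iff' measurableSet_Icc).2 (Filter.Eventually.of_forall fun θ hθ => ?_))
  · refine (volterra_integrable hk (integrable_const (1 : ℝ))
      hφ).swap.aestronglyMeasurable.integral_prod_right'.congr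
      ((ae_restrict_iff' measurableSet_Icc).2 (Filter.Eventually.of_forall fun η hη => ?_))
    dsimp only [Function.comp, Prod.swap]
    rw [integral_cut_right hη]
    simp only [mul_one]
  · rw [integral_cut_right hθ]
    refine (norm_integral_le_integral_norm _).trans
      (integral_mono_of_nonneg (Filter.Eventually.of_forall fun _ => norm_nonneg _)
        (hk.abs.const_mul _) ?_)
    refine (ae_restrict_iff' measurableSet_Icc).2 (Filter.Eventually.of_forall fun η hη => ?_)
    dsimp only
    split_ifs with h
    · rw [norm_mul, mul_comm]; exact mul_le_mul_of_nonneg_right (hC _ hη _ hθ) (abs_nonneg _)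
    · rw [norm_zero]; positivity

variable {m n p : Type} [Fintype n]

/-- Expand both products into entries and apply the scalar exchange to each; the rest is
integrability of the single terms. -/
lemma intV_volterra_swap [Fintype p] (hab : a ≤ b) {k : ℝ → Matrix m n ℝ} {Φ : ℝ → Matrix n p ℝ}
    {v : ℝ → Vec p} (hk : MemL2Mat a b k) (hΦ : ∀ i j, Continuous fun s => Φ s i j)
    (hv : MemLp v 2 (vol a b)) :
    intV a b (fun η => mv (k η) (intV a η fun θ => mv (Φ (η - θ)) (v θ)))
      = intV a b fun θ => mv (matInt θ b fun η => k η * Φ (η - θ)) (v θ) := by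
  have hv' : ∀ j, MemLp (fun θ => v θ j) 2 (vol a b) := fun j => hv.eval_piLp j
  have hv1 : ∀ j, Integrable (fun θ => v θ j) (vol a b) := fun j => (hv' j).integrable (by norm_num)
  have hsub : ∀ {η : ℝ} (_ : η ∈ Icc a b) (c : n) (j : p),
      IntervalIntegrable (fun θ => Φ (η - θ) c j * v θ j) volume a η := fun {η} hη c j =>
    (intervalIntegrable_of_vol hη.1 ((hv1 j).mono_measure (vol_le_left hη))).continuousOn_mul
      (((hΦ c j).comp (by fun_prop : Continuous fun θ => η - θ)).continuousOn)
  have hsub' : ∀ {θ : ℝ} (_ : θ ∈ Icc a b) (i : m) (c : n) (j : p),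
      IntervalIntegrable (fun η => k η i c * Φ (η - θ) c j) volume θ b := fun {θ} hθ i c j =>
    (intervalIntegrable_of_vol hθ.2 ((hk.integrable i c).mono_measure
      (vol_le_right hθ))).mul_continuousOn
      (((hΦ c j).comp (by fun_prop : Continuous fun η => η - θ)).continuousOn)
  ext i
  simp only [intV_apply, mv_apply, matInt, Matrix.of_apply, Matrix.mul_apply]
  have hl : ∀ η ∈ uIcc a b,
      ∑ c, k η i c * ∫ θ in a..η, ∑ j, Φ (η - θ) c j * v θ j
        = ∑ c, ∑ j, k η i c * ∫ θ in a..η, Φ (η - θ) c j * v θ j := fun η hη => by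
    rw [uIcc_of_le hab] at hη
    refine Finset.sum_congr rfl fun c _ => ?_
    rw [intervalIntegral.integral_finsetSum fun j _ => hsub hη c j, Finset.mul_sum]
  have hr : ∀ θ ∈ uIcc a b,
      ∑ j, (∫ η in θ..b, ∑ c, k η i c * Φ (η - θ) c j) * v θ j
        = ∑ c, ∑ j, (∫ η in θ..b, k η i c * Φ (η - θ) c j) * v θ j := fun θ hθ => by
    rw [uIcc_of_le hab] at hθ
    rw [Finset.sum_comm]
    refine Finset.sum_congr rfl fun j _ => ?_
    rw [intervalIntegral.integral_finsetSum fun c _ => hsub' hθ i c j, Finset.sum_mul]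
  rw [intervalIntegral.integral_congr hl, intervalIntegral.integral_congr hr]
  have il : ∀ c j, IntervalIntegrable
      (fun η => k η i c * ∫ θ in a..η, Φ (η - θ) c j * v θ j) volume a b := fun c j =>
    intervalIntegrable_of_vol hab (((memLp_volterra (hv1 j) (hΦ c j)).mul' (p := 2) (q := ⊤)
      (r := 2) (hk i c)).integrable (by norm_num))
  have ir : ∀ c j, IntervalIntegrable
      (fun θ => (∫ η in θ..b, k η i c * Φ (η - θ) c j) * v θ j) volume a b := fun c j =>
    intervalIntegrable_of_vol hab (((hv' j).mul' (p := ⊤) (q := 2)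
      (r := 2) (memLp_volterra_adjoint (hk.integrable i c) (hΦ c j))).integrable (by norm_num))
  have il' : ∀ c, IntervalIntegrable
      (fun η => ∑ j, k η i c * ∫ θ in a..η, Φ (η - θ) c j * v θ j) volume a b := fun c => by
    simpa [Finset.sum_fn] using IntervalIntegrable.sum Finset.univ fun j _ => il c j
  have ir' : ∀ c, IntervalIntegrable
      (fun θ => ∑ j, (∫ η in θ..b, k η i c * Φ (η - θ) c j) * v θ j) volume a b := fun c => by
    simpa [Finset.sum_fn] using IntervalIntegrable.sum Finset.univ fun j _ => ir c j
  rw [intervalIntegral.integral_finsetSum fun c _ => il' c,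
    intervalIntegral.integral_finsetSum fun c _ => ir' c]
  refine Finset.sum_congr rfl fun c _ => ?_
  rw [intervalIntegral.integral_finsetSum fun j _ => il c j,
    intervalIntegral.integral_finsetSum fun j _ => ir c j]
  exact Finset.sum_congr rfl fun j _ =>
    integral_volterra_swap hab (hk.integrable i c) (hv1 j) (hΦ c j)

/-- Covers the term `∫ₛᵇ B_I U₂ Q(θ - s) dθ` of `B_Q`: it is bounded although `B_I` is only square
integrable. -/
lemma MemLinfMat.volterra_adjoint {k : ℝ → Matrix m n ℝ} {Φ : ℝ → Matrix n p ℝ}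
    (hk : MemL2Mat a b k) (hΦ : ∀ i j, Continuous fun s => Φ s i j) :
    MemLinfMat a b fun θ => matInt θ b fun η => k η * Φ (η - θ) := fun i j => by
  refine (memLp_congr_ae ((ae_restrict_iff' measurableSet_Icc).2
    (Filter.Eventually.of_forall fun θ hθ => ?_))).1 (memLp_finsetSum Finset.univ fun c _ =>
      memLp_volterra_adjoint (hk.integrable i c) (hΦ c j))
  simp only [matInt, Matrix.of_apply, Matrix.mul_apply]
  rw [intervalIntegral.integral_finsetSum]
  exact fun c _ => (intervalIntegrable_of_vol hθ.2 ((hk.integrable i c).mono_measure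
      (vol_le_right hθ))).mul_continuousOn
      (((hΦ c j).comp (by fun_prop : Continuous fun η => η - θ)).continuousOn)

lemma memLp_intV_volterra [Fintype p] {Φ : ℝ → Matrix n p ℝ} {v : ℝ → Vec p}
    (hΦ : ∀ i j, Continuous fun s => Φ s i j) (hv : MemLp v 2 (vol a b)) :
    MemLp (fun η => intV a η fun θ => mv (Φ (η - θ)) (v θ)) ⊤ (vol a b) := by
  have hv1 : ∀ j, Integrable (fun θ => v θ j) (vol a b) :=
    fun j => (hv.eval_piLp j).integrable (by norm_num)
  refine MemLp.of_eval_piLp fun i => ?_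
  refine (memLp_congr_ae ((ae_restrict_iff' measurableSet_Icc).2
    (Filter.Eventually.of_forall fun η hη => ?_))).1 (memLp_finsetSum Finset.univ fun j _ =>
      memLp_volterra (hv1 j) (hΦ i j))
  simp only [intV_apply, mv_apply]
  rw [intervalIntegral.integral_finsetSum]
  exact fun j _ =>
    (intervalIntegrable_of_vol hη.1 ((hv1 j).mono_measure (vol_le_left hη))).continuousOn_mul
      (((hΦ i j).comp (by fun_prop : Continuous fun θ => η - θ)).continuousOn)

end Volterra

/-! ### Taylor's formula with integral remainder -/

lemma continuous_tau (i : ℕ) : Continuous (tau i) := by unfold tau; fun_prop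

@[simp] lemma tau_zero (s : ℝ) : tau 0 s = 1 := by simp [tau]

lemma tau_succ_zero (i : ℕ) : tau (i + 1) 0 = 0 := by simp [tau]

lemma integral_tau (i : ℕ) (θ s : ℝ) : ∫ η in θ..s, tau i (η - θ) = tau (i + 1) (s - θ) := by
  rw [intervalIntegral.integral_comp_sub_right (fun x => tau i x)]
  simp only [tau, sub_self, intervalIntegral.integral_div, integral_pow, Nat.factorial_succ]
  push_cast
  have : ((i : ℝ) + 1) ≠ 0 := by positivity
  field_simp
  simp

/-- Cauchy's formula for repeated integration: after the exchange with `k = 1`, the inner integral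
of `τᵢ` is `τᵢ₊₁`. -/
lemma integral_cauchy {a s : ℝ} (has : a ≤ s) (i : ℕ) {g : ℝ → ℝ} (hg : Integrable g (vol a s)) :
    ∫ η in a..s, ∫ θ in a..η, tau i (η - θ) * g θ = ∫ θ in a..s, tau (i + 1) (s - θ) * g θ := by
  have h := integral_volterra_swap has (integrable_const (1 : ℝ)) hg (continuous_tau i)
  simpa only [one_mul, integral_tau] using h

section Taylor

variable {N : ℕ} {n : Fin (N + 1) → ℕ} {a b : ℝ}

lemma continuous_Tmat (i j : CIdx n) : Continuous fun s => Tmat n s i j := by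
  simp only [Tmat, Matrix.of_apply]
  split_ifs
  · exact continuous_tau _
  · exact continuous_const

lemma continuous_Qmat (i : CIdx n) (j : XIdx n) : Continuous fun s => Qmat n s i j := by
  simp only [Qmat, Matrix.of_apply]
  split_ifs
  · exact continuous_tau _
  · exact continuous_const

lemma Tmat_mv_apply (s : ℝ) (c : Vec (CIdx n)) (x : XIdx n) (j : Fin (x.1 : ℕ)) :
    mv (Tmat n s) c ⟨x, j⟩
      = ∑ k : Fin (x.1 : ℕ), (if (j : ℕ) ≤ k then tau (k - j) s else 0) * c ⟨x, k⟩ := by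
  rw [mv_apply, Fintype.sum_sigma, Finset.sum_eq_single x]
  · simp [Tmat]
  · intro y _ hy
    exact Finset.sum_eq_zero fun k _ => by simp [Tmat, hy.symm]
  · simp

lemma Qmat_mv_apply (s : ℝ) (v : Vec (XIdx n)) (x : XIdx n) (j : Fin (x.1 : ℕ)) :
    mv (Qmat n s) v ⟨x, j⟩ = tau ((x.1 : ℕ) - 1 - j) s * v x := by
  rw [mv_apply, Finset.sum_eq_single x]
  · simp [Qmat]
  · intro y _ hy
    simp [Qmat, hy.symm]
  · simp

lemma U1mat_mv_last (v : Vec (XIdx n)) (x : XIdx n) : mv (U1mat n) v ⟨x, Fin.last _⟩ = v x := by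
  rw [mv_apply, Finset.sum_eq_single x]
  · simp [U1mat]
  · intro y _ hy
    simp [U1mat, hy.symm]
  · simp

lemma U1mat_mv_castSucc (v : Vec (XIdx n)) (x : XIdx n) (j : Fin (x.1 : ℕ)) :
    mv (U1mat n) v ⟨x, j.castSucc⟩ = 0 := by
  rw [mv_apply]
  refine Finset.sum_eq_zero fun y _ => ?_
  have : ¬ (x = y ∧ (j : ℕ) = (y.1 : ℕ)) := by
    rintro ⟨rfl, h⟩; exact absurd h j.2.ne
  simp [U1mat, this]

lemma U2mat_mv_last (c : Vec (CIdx n)) (x : XIdx n) : mv (U2mat n) c ⟨x, Fin.last _⟩ = 0 := by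
  rw [mv_apply]
  refine Finset.sum_eq_zero fun d _ => ?_
  have : ¬ (x = d.1 ∧ (x.1 : ℕ) = (d.2 : ℕ)) := by
    rcases d with ⟨y, k⟩
    rintro ⟨h, h'⟩
    simp only at h h'
    subst h; exact absurd h'.symm k.2.ne
  simp [U2mat, this]

lemma U2mat_mv_castSucc (c : Vec (CIdx n)) (x : XIdx n) (j : Fin (x.1 : ℕ)) :
    mv (U2mat n) c ⟨x, j.castSucc⟩ = c ⟨x, j⟩ := by
  rw [mv_apply, Finset.sum_eq_single ⟨x, j⟩]
  · simp [U2mat]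
  · rintro ⟨y, k⟩ _ hy
    have : ¬ (x = y ∧ (j : ℕ) = (k : ℕ)) := by
      rintro ⟨rfl, h⟩
      exact hy (by rw [Fin.ext h])
    simp [U2mat, this]
  · simp

/-- The lower order derivatives `C x̂` reconstructed from `(C x̂)(a) = c` and `D x̂ = v`. -/
def taylorC (a : ℝ) (c : Vec (CIdx n)) (v : ℝ → Vec (XIdx n)) (s : ℝ) : Vec (CIdx n) :=
  mv (Tmat n (s - a)) c + intV a s fun θ => mv (Qmat n (s - θ)) (v θ)

/-- All derivatives `F x̂` reconstructed from `(C x̂)(a) = c` and `D x̂ = v`. -/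
def taylorF (a : ℝ) (c : Vec (CIdx n)) (v : ℝ → Vec (XIdx n)) (s : ℝ) : Vec (FIdx n) :=
  mv (U1mat n) (v s) + mv (U2mat n) (taylorC a c v s)

lemma taylorF_last (c : Vec (CIdx n)) (v : ℝ → Vec (XIdx n)) (s : ℝ) (x : XIdx n) :
    taylorF a c v s ⟨x, Fin.last _⟩ = v s x := by
  simp [taylorF, U1mat_mv_last, U2mat_mv_last]

lemma taylorF_castSucc (c : Vec (CIdx n)) (v : ℝ → Vec (XIdx n)) (s : ℝ) (x : XIdx n)
    (j : Fin (x.1 : ℕ)) : taylorF a c v s ⟨x, j.castSucc⟩ = taylorC a c v s ⟨x, j⟩ := by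
  simp [taylorF, U1mat_mv_castSucc, U2mat_mv_castSucc]

lemma taylorC_apply (c : Vec (CIdx n)) (v : ℝ → Vec (XIdx n)) (s : ℝ) (x : XIdx n)
    (j : Fin (x.1 : ℕ)) : taylorC a c v s ⟨x, j⟩
      = ∑ k : Fin (x.1 : ℕ), (if (j : ℕ) ≤ k then tau (k - j) (s - a) else 0) * c ⟨x, k⟩
        + ∫ θ in a..s, tau ((x.1 : ℕ) - 1 - j) (s - θ) * v θ x := by
  rw [taylorC, PiLp.add_apply, Tmat_mv_apply, intV_apply]
  simp only [Qmat_mv_apply]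

/-- At `s = a` the remainder vanishes, and among the `τ_{k-j}(0)` only the one with `k = j`
survives. -/
lemma taylorC_left (c : Vec (CIdx n)) (v : ℝ → Vec (XIdx n)) : taylorC a c v a = c := by
  ext ⟨x, j⟩
  rw [taylorC_apply, intervalIntegral.integral_same, add_zero, Finset.sum_eq_single j]
  · simp
  · intro k _ hk
    split_ifs with h
    · obtain ⟨m, hm⟩ : ∃ m, (k : ℕ) - j = m + 1 :=
        ⟨k - j - 1, by have : (k : ℕ) ≠ j := fun h => hk (Fin.ext h)
                       omega⟩
      rw [sub_self, hm, tau_succ_zero, zero_mul]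
    · simp
  · simp

/-- Integrating the Taylor expansion of the derivative of order `j + 1` reproduces that of order
`j`: each `τ` gains one index, and the missing constant term is the initial value. -/
lemma taylorF_ftc {v : ℝ → Vec (XIdx n)} (hv : MemLp v 2 (vol a b)) (c : Vec (CIdx n))
    (d : CIdx n) {s : ℝ} (hs : s ∈ Icc a b) :
    taylorF a c v s ⟨d.1, d.2.castSucc⟩
      = taylorF a c v a ⟨d.1, d.2.castSucc⟩ + ∫ θ in a..s, taylorF a c v θ ⟨d.1, d.2.succ⟩ := by
  obtain ⟨x, j⟩ := d
  have hv1 : Integrable (fun θ => v θ x) (vol a s) :=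
    ((hv.eval_piLp x).integrable (by norm_num)).mono_measure (vol_le_left hs)
  simp only [taylorF_castSucc, taylorC_left]
  rw [taylorC_apply]
  -- The next derivative is either the highest one, which is `v` itself, or again given by a Taylor
  -- expansion.
  generalize hq : j.succ = q
  induction q using Fin.lastCases with
  | last =>
    have hj : (j : ℕ) + 1 = x.1 := by simpa using congrArg Fin.val hq
    simp only [taylorF_last]
    congr 1
    · rw [Finset.sum_eq_single j]
      · simp
      · intro k _ hk
        have : ¬ (j : ℕ) ≤ k := fun h => hk (Fin.ext (by have := k.2; omega))
        simp [this]
      · simp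
    · have : (x.1 : ℕ) - 1 - j = 0 := by omega
      simp [this]
  | cast j' =>
    have hj : (j' : ℕ) = j + 1 := by simpa using (congrArg Fin.val hq).symm
    simp only [taylorF_castSucc, taylorC_apply]
    have hm : (x.1 : ℕ) - 1 - j = ((x.1 : ℕ) - 1 - j') + 1 := by have := j'.2; omega
    have hcont : ∀ k : Fin (x.1 : ℕ), Continuous fun θ =>
        (if (j' : ℕ) ≤ k then tau (k - j') (θ - a) else 0) * c ⟨x, k⟩ := fun k => by
      split_ifs
      · exact ((continuous_tau _).comp (continuous_id.sub continuous_const)).mul continuous_const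
      · simpa using continuous_const
    rw [intervalIntegral.integral_add
      ((continuous_finsetSum _ fun k _ => hcont k).intervalIntegrable _ _)
      (intervalIntegrable_of_vol hs.1 ((memLp_volterra hv1 (continuous_tau _)).integrable le_top)),
      integral_cauchy hs.1 _ hv1, ← hm, ← add_assoc,
      intervalIntegral.integral_finsetSum fun k _ => (hcont k).intervalIntegrable _ _]
    congr 1
    -- The term `k = j` is isolated: on the left it is the initial value `c ⟨x, j⟩`, while under the
    -- integral it is absent since `j' = j + 1 > j`.
    rw [← Finset.add_sum_erase _ _ (Finset.mem_univ j),
      ← Finset.add_sum_erase (a := j) _ (fun k => ∫ θ in a..s, _) (Finset.mem_univ j)]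
    have h1 : ¬ (j' : ℕ) ≤ j := by omega
    simp only [le_refl, if_true, Nat.sub_self, tau_zero, one_mul, h1, if_false, zero_mul,
      intervalIntegral.integral_zero, zero_add]
    congr 1
    refine Finset.sum_congr rfl fun k hk => ?_
    have hkj : (k : ℕ) ≠ j := fun h => (Finset.ne_of_mem_erase hk) (Fin.ext h)
    rw [intervalIntegral.integral_mul_const]
    congr 1
    by_cases hle : (j : ℕ) ≤ k
    · have hle' : (j' : ℕ) ≤ k := by omega
      have : (k : ℕ) - j = (k - j') + 1 := by omega
      simp only [hle, hle', if_true, integral_tau, this]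
    · have hle' : ¬ (j' : ℕ) ≤ k := by omega
      simp [hle, hle']

lemma memLp_taylorC {v : ℝ → Vec (XIdx n)} (hv : MemLp v 2 (vol a b)) (c : Vec (CIdx n)) :
    MemLp (taylorC a c v) ⊤ (vol a b) := by
  refine MemLp.add (MemLp.of_eval_piLp fun i => ?_) (memLp_intV_volterra continuous_Qmat hv)
  simp only [mv_apply]
  exact memLp_finsetSum _ fun j _ => ((MemLinfMat.of_continuous a b (M := fun s => Tmat n (s - a))
    fun i j => (continuous_Tmat i j).comp (by fun_prop)) i j).mul_const _

lemma memLp_taylorF {v : ℝ → Vec (XIdx n)} (hv : MemLp v 2 (vol a b)) (c : Vec (CIdx n)) :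
    MemLp (taylorF a c v) 2 (vol a b) :=
  ((mvL (U1mat n)).comp_memLp' hv).add
    ((mvL (U2mat n)).comp_memLp' ((memLp_taylorC hv c).mono_exponent le_top))

/-- The element `x̂` of `Wⁿ` with `(C x̂)(a) = c` and `D x̂ = V`. -/
def Sob.ofData (c : Vec (CIdx n)) (V : L2 a b (XIdx n)) : Sob a b n where
  F := taylorF a c V
  memLp := memLp_taylorF (Lp.memLp V) c
  ftc := fun d _ hs => taylorF_ftc (Lp.memLp V) c d hs

/-- `(C x̂)(a)`. -/
def Sob.left (f : Sob a b n) : Vec (CIdx n) := WithLp.toLp 2 fun d => f.F a ⟨d.1, d.2.castSucc⟩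

/-- `D x̂` as a continuous linear function of the class of `F x̂`. -/
def topL (a b : ℝ) (n : Fin (N + 1) → ℕ) : L2 a b (FIdx n) →L[ℝ] L2 a b (XIdx n) :=
  (mvL (U1mat n)ᵀ).compLpL 2 (vol a b)

/-- `D x̂` as an element of `L₂`. -/
def Sob.top (f : Sob a b n) : L2 a b (XIdx n) := topL a b n f.jet

lemma U1mat_transpose_mv (y : Vec (FIdx n)) (x : XIdx n) :
    mv (U1mat n)ᵀ y x = y ⟨x, Fin.last _⟩ := by
  rw [mv_apply, Fintype.sum_sigma, Finset.sum_eq_single x]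
  · rw [Finset.sum_eq_single (Fin.last _)]
    · simp [U1mat]
    · intro j _ hj
      have : (j : ℕ) ≠ x.1 := fun h => hj (Fin.ext h)
      simp [U1mat, this]
    · simp
  · intro y _ hy
    exact Finset.sum_eq_zero fun k _ => by simp [U1mat, hy]
  · simp

lemma Sob.top_ae (f : Sob a b n) : ∀ᵐ s ∂(vol a b), ∀ x, f.top s x = f.F s ⟨x, Fin.last _⟩ := by
  filter_upwards [(mvL (U1mat n)ᵀ).coeFn_compLp f.jet, f.memLp.coeFn_toLp] with s h1 h2 x
  have : f.top s = mv (U1mat n)ᵀ (f.jet s) := h1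
  rw [this, U1mat_transpose_mv, Sob.jet, h2]

@[simp] lemma Sob.left_ofData (c : Vec (CIdx n)) (V : L2 a b (XIdx n)) :
    (Sob.ofData c V).left = c := by
  ext ⟨x, j⟩
  change taylorF a c V a ⟨x, j.castSucc⟩ = _
  rw [taylorF_castSucc, taylorC_left]

@[simp] lemma Sob.top_ofData (c : Vec (CIdx n)) (V : L2 a b (XIdx n)) :
    (Sob.ofData c V).top = V := by
  refine Lp.ext ((Sob.ofData c V).top_ae.mono fun s hs => ?_)
  ext x
  rw [hs]
  exact taylorF_last _ _ _ _

/-- Elements of `Wⁿ` with the same value of `(C x̂)(a)` and almost everywhere the same `D x̂`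
agree. -/
lemma Sob.eq_of_left_of_top {f g : Sob a b n} (hl : f.left = g.left) (ht : f.top = g.top) :
    (∀ s ∈ Icc a b, ∀ d : CIdx n, f.F s ⟨d.1, d.2.castSucc⟩ = g.F s ⟨d.1, d.2.castSucc⟩) ∧
      f.F =ᵐ[vol a b] g.F := by
  have htop : ∀ᵐ s ∂(vol a b), ∀ x, f.F s ⟨x, Fin.last _⟩ = g.F s ⟨x, Fin.last _⟩ := by
    filter_upwards [f.top_ae, g.top_ae] with s h1 h2 x
    rw [← h1, ← h2, ht]
  have hC : ∀ (x : XIdx n) (j : Fin (x.1 : ℕ)), ∀ s ∈ Icc a b,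
      f.F s ⟨x, j.castSucc⟩ = g.F s ⟨x, j.castSucc⟩ := by
    intro x j
    -- Downward induction on the order `j`, starting next to the highest derivative: equality of the
    -- derivatives of order `j + 1` and of the values at `a` integrates to equality at order `j`.
    generalize hm : (x.1 : ℕ) - j = m
    induction m using Nat.strong_induction_on generalizing j with
    | _ m ih =>
      intro s hs
      rw [f.ftc ⟨x, j⟩ s hs, g.ftc ⟨x, j⟩ s hs]
      have h0 : f.F a ⟨x, j.castSucc⟩ = g.F a ⟨x, j.castSucc⟩ :=
        congrArg (fun c : Vec (CIdx n) => c ⟨x, j⟩) hl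
      simp only [h0]
      congr 1
      rw [integral_eq_vol hs.1, integral_eq_vol hs.1]
      refine integral_congr_ae (ae_mono (vol_le_left hs) ?_)
      generalize hq : j.succ = q
      induction q using Fin.lastCases with
      | last => exact htop.mono fun s h => h x
      | cast j' =>
        have hj : (j' : ℕ) = j + 1 := by simpa using (congrArg Fin.val hq).symm
        exact (ae_restrict_iff' measurableSet_Icc).2 (Filter.Eventually.of_forall fun θ hθ =>
          ih _ (by have := j'.2; omega) j' rfl θ hθ)
  refine ⟨fun s hs d => hC d.1 d.2 s hs, ?_⟩
  filter_upwards [htop, ae_restrict_mem measurableSet_Icc] with s h1 h2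
  ext ⟨x, j⟩
  induction j using Fin.lastCases with
  | last => exact h1 x
  | cast j => exact hC x j s h2

lemma Sob.jet_eq {f g : Sob a b n} (h : f.F =ᵐ[vol a b] g.F) : f.jet = g.jet :=
  MemLp.toLp_congr _ _ h

lemma toL2_congr {ι : Type} [Fintype ι] {f g : ℝ → Vec ι} (h : f =ᵐ[vol a b] g) :
    toL2 a b f = toL2 a b g := by
  unfold toL2
  by_cases hf : MemLp f 2 (vol a b)
  · rw [dif_pos hf, dif_pos ((memLp_congr_ae h).1 hf)]
    exact MemLp.toLp_congr _ _ h
  · rw [dif_neg hf, dif_neg fun hg => hf ((memLp_congr_ae h).2 hg)]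

lemma Sob.state_eq {f g : Sob a b n} (h : f.F =ᵐ[vol a b] g.F) : f.state = g.state :=
  toL2_congr (h.mono fun s hs => by simp [hs])

/-- Boundary values are point values, so almost everywhere equality of `F` would not suffice here.
-/
lemma Sob.bdry_eq (hab : a ≤ b) {f g : Sob a b n}
    (h : ∀ s ∈ Icc a b, ∀ d : CIdx n, f.F s ⟨d.1, d.2.castSucc⟩ = g.F s ⟨d.1, d.2.castSucc⟩) :
    f.bdry = g.bdry := by
  ext (d | d)
  · exact h a (left_mem_Icc.2 hab) d
  · exact h b (right_mem_Icc.2 hab) d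

/-! ### Boundedness of the reconstruction -/

lemma norm_le_sum_abs {ι : Type} [Fintype ι] (x : Vec ι) : ‖x‖ ≤ ∑ i, |x i| := by
  classical
  have h := (EuclideanSpace.basisFun ι ℝ).sum_repr x
  calc ‖x‖ = ‖∑ i, (EuclideanSpace.basisFun ι ℝ).repr x i • EuclideanSpace.basisFun ι ℝ i‖ := by
        rw [h]
    _ ≤ _ := (norm_sum_le _ _).trans (Finset.sum_le_sum fun i _ => by simp [norm_smul])

/-- Hölder's inequality on an interval of finite length; the constant is the total mass to the power
`1 - 1/2`. -/
lemma exists_integral_abs_le (a b : ℝ) (ι : Type) [Fintype ι] :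
    ∃ C, 0 ≤ C ∧ ∀ (V : L2 a b ι) (x : ι), ∫ θ, |V θ x| ∂(vol a b) ≤ C * ‖V‖ := by
  refine ⟨((vol a b) univ ^ (1 / (1 : ENNReal).toReal - 1 / (2 : ENNReal).toReal)).toReal,
    ENNReal.toReal_nonneg, fun V x => ?_⟩
  have hV : MemLp V 2 (vol a b) := Lp.memLp V
  have hV1 : Integrable V (vol a b) := hV.integrable (by norm_num)
  have h1 : ∫ θ, |V θ x| ∂(vol a b) ≤ ∫ θ, ‖V θ‖ ∂(vol a b) :=
    integral_mono_of_nonneg (Filter.Eventually.of_forall fun _ => abs_nonneg _) hV1.norm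
      (Filter.Eventually.of_forall fun θ => PiLp.norm_apply_le (V θ) x)
  refine h1.trans ?_
  rw [integral_norm_eq_lintegral_enorm hV.1, ← eLpNorm_one_eq_lintegral_enorm, Lp.norm_def,
    mul_comm, ← ENNReal.toReal_mul]
  refine ENNReal.toReal_mono (ENNReal.mul_ne_top hV.2.ne ?_)
    (eLpNorm_le_eLpNorm_mul_rpow_measure_univ (by norm_num) hV.1)
  exact ENNReal.rpow_ne_top_of_nonneg (by norm_num) (measure_ne_top _ _)

/-- The Taylor polynomial has coefficients bounded on the compact interval, and the remainder is
controlled by the `L₁` norm, hence by the `L₂` norm, of `V`. The two parts contribute `∑ |A k|` and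
`C * L`. -/
lemma exists_taylorC_bound (a b : ℝ) (n : Fin (N + 1) → ℕ) :
    ∃ K, 0 ≤ K ∧ ∀ (c : Vec (CIdx n)) (V : L2 a b (XIdx n)), ∀ s ∈ Icc a b,
      ‖taylorC a c V s‖ ≤ K * (‖c‖ + ‖V‖) := by
  have key : ∀ d : CIdx n, ∃ K, 0 ≤ K ∧ ∀ (c : Vec (CIdx n)) (V : L2 a b (XIdx n)),
      ∀ s ∈ Icc a b, |taylorC a c V s d| ≤ K * (‖c‖ + ‖V‖) := by
    rintro ⟨x, j⟩
    obtain ⟨C, hC0, hC⟩ := exists_volterra_bound a b (continuous_tau ((x.1 : ℕ) - 1 - j))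
    obtain ⟨L, hL0, hL⟩ := exists_integral_abs_le a b (XIdx n)
    have hk : ∀ k : Fin (x.1 : ℕ), ∃ A, ∀ s ∈ Icc a b,
        ‖(if (j : ℕ) ≤ k then tau (k - j) (s - a) else 0 : ℝ)‖ ≤ A := fun k => by
      refine isCompact_Icc.exists_bound_of_continuousOn (Continuous.continuousOn ?_)
      split_ifs
      · exact (continuous_tau _).comp (by fun_prop)
      · exact continuous_const
    choose A hA using hk
    refine ⟨∑ k, |A k| + C * L, by positivity, fun c V s hs => ?_⟩
    have hV1 : Integrable (fun θ => V θ x) (vol a b) :=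
      ((Lp.memLp V).eval_piLp x).integrable (by norm_num)
    rw [taylorC_apply]
    have e1 : |∑ k : Fin (x.1 : ℕ), (if (j : ℕ) ≤ k then tau (k - j) (s - a) else 0) * c ⟨x, k⟩|
        ≤ (∑ k, |A k|) * ‖c‖ := by
      rw [Finset.sum_mul]
      refine (Finset.abs_sum_le_sum_abs _ _).trans (Finset.sum_le_sum fun k _ => ?_)
      rw [abs_mul]
      exact mul_le_mul ((hA k s hs).trans (le_abs_self _)) (PiLp.norm_apply_le c _)
        (abs_nonneg _) (abs_nonneg _)
    have e2 : |∫ θ in a..s, tau ((x.1 : ℕ) - 1 - j) (s - θ) * V θ x| ≤ C * L * ‖V‖ := by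
      refine (hC _ hV1 s hs).trans ?_
      rw [mul_assoc]
      exact mul_le_mul_of_nonneg_left (hL V x) hC0
    have e3 : 0 ≤ ∑ k, |A k| := by positivity
    have e4 : 0 ≤ C * L := by positivity
    refine (abs_add_le _ _).trans ((add_le_add e1 e2).trans ?_)
    nlinarith [norm_nonneg c, norm_nonneg V, mul_nonneg e3 (norm_nonneg V),
      mul_nonneg e4 (norm_nonneg c)]
  choose K hK0 hK using key
  refine ⟨∑ d, K d, Finset.sum_nonneg fun d _ => hK0 d, fun c V s hs => ?_⟩
  rw [Finset.sum_mul]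
  exact (norm_le_sum_abs _).trans (Finset.sum_le_sum fun d _ => hK d c V s hs)

lemma integrable_Qmat_mv {v : ℝ → Vec (XIdx n)} (hv : MemLp v 2 (vol a b)) {s : ℝ}
    (hs : s ∈ Icc a b) (i : CIdx n) :
    Integrable (fun θ => mv (Qmat n (s - θ)) (v θ) i) (vol a s) :=
  (MemL2Mat.of_linf (MemLinfMat.of_continuous a s (M := fun θ => Qmat n (s - θ))
    fun i j => (continuous_Qmat i j).comp (by fun_prop))).mv_integrable
    (hv.mono_measure (vol_le_left hs)) i

/-- The sum in `L₂` is a pointwise sum only almost everywhere on `[a, b]`, which is why `s` is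
confined to that interval. -/
lemma taylorC_add (c c' : Vec (CIdx n)) (V V' : L2 a b (XIdx n)) {s : ℝ} (hs : s ∈ Icc a b) :
    taylorC a (c + c') (V + V' : L2 a b (XIdx n)) s = taylorC a c V s + taylorC a c' V' s := by
  have h : intV a s (fun θ => mv (Qmat n (s - θ)) ((V + V' : L2 a b (XIdx n)) θ))
      = intV a s (fun θ => mv (Qmat n (s - θ)) (V θ) + mv (Qmat n (s - θ)) (V' θ)) :=
    intV_congr hs.1 (Filter.Eventually.mono (ae_mono (vol_le_left hs) (Lp.coeFn_add V V')) fun θ hθ => by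
      dsimp only
      rw [hθ, Pi.add_apply, mv_add])
  rw [taylorC, h, intV_add hs.1 (integrable_Qmat_mv (Lp.memLp V) hs)
    (integrable_Qmat_mv (Lp.memLp V') hs), mv_add, taylorC, taylorC]
  abel

lemma taylorC_smul (r : ℝ) (c : Vec (CIdx n)) (V : L2 a b (XIdx n)) {s : ℝ} (hs : s ∈ Icc a b) :
    taylorC a (r • c) (r • V : L2 a b (XIdx n)) s = r • taylorC a c V s := by
  have h : intV a s (fun θ => mv (Qmat n (s - θ)) ((r • V : L2 a b (XIdx n)) θ))
      = r • intV a s (fun θ => mv (Qmat n (s - θ)) (V θ)) := by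
    rw [intV_congr hs.1 (g := fun θ => r • mv (Qmat n (s - θ)) (V θ))
      (Filter.Eventually.mono (ae_mono (vol_le_left hs) (Lp.coeFn_smul r V)) fun θ hθ => by
        dsimp only
        rw [hθ, Pi.smul_apply, mv_smul])]
    ext i
    simp [intV_apply]
  rw [taylorC, h, mv_smul, taylorC, smul_add]

lemma memLp_lower (c : Vec (CIdx n)) (V : L2 a b (XIdx n)) :
    MemLp (fun s => mv (U2mat n) (taylorC a c V s)) 2 (vol a b) :=
  (mvL (U2mat n)).comp_memLp' ((memLp_taylorC (Lp.memLp V) c).mono_exponent le_top)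

/-- The lower order part of `F x̂` as a linear function of `(C x̂)(a)` and `D x̂`. -/
def lowerLin (a b : ℝ) (n : Fin (N + 1) → ℕ) :
    (Vec (CIdx n) × L2 a b (XIdx n)) →ₗ[ℝ] L2 a b (FIdx n) where
  toFun p := (memLp_lower p.1 p.2).toLp _
  map_add' p q := by
    rw [← MemLp.toLp_add]
    refine MemLp.toLp_congr _ _ ((ae_restrict_iff' measurableSet_Icc).2
      (Filter.Eventually.of_forall fun s hs => ?_))
    simp only [Prod.fst_add, Prod.snd_add, Pi.add_apply]
    rw [taylorC_add _ _ _ _ hs, mv_add]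
  map_smul' r p := by
    rw [RingHom.id_apply, ← MemLp.toLp_const_smul]
    refine MemLp.toLp_congr _ _ ((ae_restrict_iff' measurableSet_Icc).2
      (Filter.Eventually.of_forall fun s hs => ?_))
    simp only [Prod.smul_fst, Prod.smul_snd, Pi.smul_apply]
    rw [taylorC_smul _ _ _ hs, mv_smul]

lemma exists_lowerLin_bound (a b : ℝ) (n : Fin (N + 1) → ℕ) :
    ∃ K, ∀ p, ‖lowerLin a b n p‖ ≤ K * ‖p‖ := by
  obtain ⟨K, hK0, hK⟩ := exists_taylorC_bound a b n
  -- A uniform bound gives an `L₂` bound times the square root of the length; the factor `2` comes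
  -- from `‖c‖ + ‖V‖ ≤ 2 ‖(c, V)‖` in the maximum norm.
  refine ⟨(measureUnivNNReal (vol a b) : ℝ) ^ (2 : ENNReal).toReal⁻¹
    * (‖mvL (U2mat n)‖ * (K * 2)), fun p => ?_⟩
  rw [mul_assoc]
  refine Lp.norm_le_of_ae_bound (by positivity) ?_
  filter_upwards [(memLp_lower p.1 p.2).coeFn_toLp, ae_restrict_mem measurableSet_Icc] with s h1 hs
  have h2 : lowerLin a b n p s = mvL (U2mat n) (taylorC a p.1 p.2 s) := h1
  rw [h2, mul_assoc]
  refine (ContinuousLinearMap.le_opNorm _ _).trans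
    (mul_le_mul_of_nonneg_left ((hK _ _ s hs).trans ?_) (norm_nonneg _))
  rw [mul_assoc]
  refine mul_le_mul_of_nonneg_left ?_ hK0
  linarith [norm_fst_le p, norm_snd_le p]

/-- The class of `F x̂` as a continuous linear function of `(C x̂)(a)` and `D x̂`. -/
def jetL (a b : ℝ) (n : Fin (N + 1) → ℕ) :
    (Vec (CIdx n) × L2 a b (XIdx n)) →L[ℝ] L2 a b (FIdx n) :=
  ((mvL (U1mat n)).compLpL 2 (vol a b)).comp (ContinuousLinearMap.snd ℝ _ _)
    + ⟨lowerLin a b n, AddMonoidHomClass.continuous_of_bound (lowerLin a b n)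
        (exists_lowerLin_bound a b n).choose (exists_lowerLin_bound a b n).choose_spec⟩

lemma Sob.jet_ofData (c : Vec (CIdx n)) (V : L2 a b (XIdx n)) :
    (Sob.ofData c V).jet = jetL a b n (c, V) := by
  refine Lp.ext ?_
  have h : jetL a b n (c, V)
      = (mvL (U1mat n)).compLp V + (memLp_lower c V).toLp _ := rfl
  rw [h]
  filter_upwards [(Sob.ofData c V).memLp.coeFn_toLp, (mvL (U1mat n)).coeFn_compLp V,
    (memLp_lower c V).coeFn_toLp, Lp.coeFn_add ((mvL (U1mat n)).compLp V)
      ((memLp_lower c V).toLp _)] with s h1 h2 h3 h4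
  rw [Sob.jet, h1, h4, Pi.add_apply, h2, h3]
  rfl

end Taylor

/-! ### Reconstruction of the PDE state from its highest derivatives -/

lemma matInv_spec {m n : Type} [Fintype m] [Fintype n] [DecidableEq m] [DecidableEq n]
    {M : Matrix m n ℝ} (h : IsInvertible M) : M * matInv M = 1 ∧ matInv M * M = 1 := by
  rw [matInv, dif_pos h]
  exact h.choose_spec

/-- Assembles the two one-sided integrals of a PI operator into one integral of a glued kernel over
`[a, b]`, where linearity can be used freely. -/
lemma intV_ite {p : Type} {a b s : ℝ} (hs : s ∈ Icc a b) {f g h : ℝ → Vec p}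
    (hh : ∀ i, Integrable (fun θ => h θ i) (vol a b))
    (hf : ∀ θ ∈ Ioo a s, f θ = h θ) (hg : ∀ θ ∈ Ioo s b, g θ = h θ) :
    intV a s f + intV s b g = intV a b h := by
  have key : ∀ {c d : ℝ}, c ≤ d → ∀ {u w : ℝ → Vec p}, (∀ θ ∈ Ioo c d, u θ = w θ) →
      intV c d u = intV c d w := fun hcd u w huw => by
    ext i
    simp only [intV_apply, intervalIntegral.integral_of_le hcd, integral_Ioc_eq_integral_Ioo]
    exact setIntegral_congr_fun measurableSet_Ioo fun θ hθ => by simp [huw θ hθ]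
  rw [key hs.1 hf, key hs.2 hg, intV_split hs hh]

/-- `V ↦ ∫ M V` as a continuous linear map, for a square integrable `M`. -/
def kernelL {p q : Type} [Fintype p] [Fintype q] {a b : ℝ} {M : ℝ → Matrix p q ℝ}
    (hM : MemL2Mat a b M) : L2 a b q →L[ℝ] Vec p :=
  (EuclideanSpace.equiv p ℝ).symm.toContinuousLinearMap.comp
    (ContinuousLinearMap.pi fun i => innerSL ℝ
      ((MemLp.of_eval_piLp fun j => hM i j :
        MemLp (fun s => (WithLp.toLp 2 (M s i) : Vec q)) 2 (vol a b)).toLp _))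

/-- Each component is an `L₂` inner product with a row of `M`, which is where continuity comes from.
-/
lemma kernelL_apply {p q : Type} [Fintype p] [Fintype q] {a b : ℝ} (hab : a ≤ b)
    {M : ℝ → Matrix p q ℝ} (hM : MemL2Mat a b M) (V : L2 a b q) :
    kernelL hM V = intV a b fun θ => mv (M θ) (V θ) := by
  ext i
  rw [intV_apply, integral_eq_vol hab]
  have h : MemLp (fun s => (WithLp.toLp 2 (M s i) : Vec q)) 2 (vol a b) :=
    MemLp.of_eval_piLp fun j => hM i j
  change inner ℝ (h.toLp _) V = _
  rw [L2.inner_def]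
  refine integral_congr_ae (h.coeFn_toLp.mono fun s hs => ?_)
  dsimp only
  rw [hs, mv_apply, PiLp.inner_apply]
  exact Finset.sum_congr rfl fun j _ => by simp [mul_comm]

section Recon

variable {N : ℕ} {n : Fin (N + 1) → ℕ} {a b : ℝ}

lemma MemL2Mat.mul_continuous {m k p : Type} [Fintype k] {M : ℝ → Matrix m k ℝ}
    (hM : MemL2Mat a b M) {Φ : ℝ → Matrix k p ℝ} (hΦ : ∀ i j, Continuous fun s => Φ s i j) :
    MemL2Mat a b fun s => M s * Φ s := hM.mul_linf (MemLinfMat.of_continuous a b hΦ)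

lemma MemL2Mat.mul_const {m k p : Type} [Fintype k] {M : ℝ → Matrix m k ℝ}
    (hM : MemL2Mat a b M) (C : Matrix k p ℝ) : MemL2Mat a b fun s => M s * C :=
  hM.mul_continuous fun _ _ => continuous_const

lemma memL2Mat_of_continuous {m k : Type} {Φ : ℝ → Matrix m k ℝ}
    (hΦ : ∀ i j, Continuous fun s => Φ s i j) : MemL2Mat a b Φ :=
  .of_linf (.of_continuous a b hΦ)

lemma continuous_Tmat_sub (a : ℝ) (i j : CIdx n) : Continuous fun s => Tmat n (s - a) i j :=
  (continuous_Tmat i j).comp (by fun_prop)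

lemma continuous_Qmat_sub (s : ℝ) (i : CIdx n) (j : XIdx n) :
    Continuous fun θ => Qmat n (s - θ) i j := (continuous_Qmat i j).comp (by fun_prop)

lemma Tmat_zero : Tmat n 0 = 1 := by
  ext ⟨x, j⟩ ⟨y, k⟩
  simp only [Tmat, Matrix.of_apply, Matrix.one_apply]
  by_cases hxy : x = y
  · subst hxy
    by_cases hjk : j = k
    · subst hjk; simp
    · have h1 : (⟨x, j⟩ : CIdx n) ≠ ⟨x, k⟩ := fun h => hjk (by simpa using h)
      rw [if_neg h1]
      split_ifs with h
      · obtain ⟨m, hm⟩ : ∃ m, (k : ℕ) - j = m + 1 :=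
          ⟨k - j - 1, by have : (j : ℕ) ≠ k := fun h => hjk (Fin.ext h)
                         have : (j : ℕ) ≤ k := h.2
                         omega⟩
        simp only [hm, tau_succ_zero]
      · rfl
  · have h1 : (⟨x, j⟩ : CIdx n) ≠ ⟨y, k⟩ := fun h => hxy (congrArg Sigma.fst h)
    simp [hxy, h1]

/-- Integrating a matrix function against the reconstructed derivatives. -/
lemma intV_mv_taylorF (hab : a ≤ b) {m : Type} {k : ℝ → Matrix m (FIdx n) ℝ}
    (hk : MemL2Mat a b k) (c : Vec (CIdx n)) {v : ℝ → Vec (XIdx n)} (hv : MemLp v 2 (vol a b)) :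
    intV a b (fun η => mv (k η) (taylorF a c v η))
      = mv (matInt a b fun η => k η * U2mat n * Tmat n (η - a)) c
        + intV a b fun θ => mv (k θ * U1mat n
            + matInt θ b fun η => k η * U2mat n * Qmat n (η - θ)) (v θ) := by
  have hT : MemL2Mat a b fun η => k η * U2mat n * Tmat n (η - a) :=
    (hk.mul_const _).mul_continuous (continuous_Tmat_sub a)
  have hQ := MemL2Mat.of_linf
    (MemLinfMat.volterra_adjoint (hk.mul_const (U2mat n)) continuous_Qmat)
  have hU := hk.mul_const (U1mat n)
  have e : (fun η => mv (k η) (taylorF a c v η)) = fun η =>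
      (mv (k η * U2mat n * Tmat n (η - a)) c + mv (k η * U1mat n) (v η))
        + mv (k η * U2mat n) (intV a η fun θ => mv (Qmat n (η - θ)) (v θ)) := by
    ext1 η
    simp only [taylorF, taylorC, mv_add, mul_mv]
    abel
  have i1 := hT.mv_integrable (memLp_const c)
  have i2 := hU.mv_integrable hv
  have i3 := (hk.mul_const (U2mat n)).mv_integrable
    ((memLp_intV_volterra continuous_Qmat hv).mono_exponent le_top)
  rw [e, intV_add hab (fun i => (i1 i).add (i2 i)) i3, intV_add hab i1 i2,
    ← mv_matInt hab hT.integrable, intV_volterra_swap hab (hk.mul_const _) continuous_Qmat hv,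
    add_assoc, ← intV_add hab i2 (hQ.mv_integrable hv)]
  simp only [add_mv]

end Recon

/-! ### Block matrices -/

section RowsCols

variable {m m' k k' : Type}

lemma mv_fromCols [Fintype k] [Fintype k'] (A : Matrix m k ℝ) (B : Matrix m k' ℝ) (x : Vec k) (y : Vec k') :
    mv (Matrix.fromCols A B) (WithLp.toLp 2 (Sum.elim x y)) = mv A x + mv B y := by
  ext i
  simp [mv_apply]

lemma MemL2Mat.fromRows {a b : ℝ} {A : ℝ → Matrix m k ℝ} {B : ℝ → Matrix m' k ℝ}
    (hA : MemL2Mat a b A) (hB : MemL2Mat a b B) :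
    MemL2Mat a b fun s => Matrix.fromRows (A s) (B s) := by
  rintro (i | i) j
  · exact hA i j
  · exact hB i j

end RowsCols

/-! ### Solving the boundary conditions for the left boundary values -/

namespace BCParam

variable {N : ℕ} {a b : ℝ} {n : Fin (N + 1) → ℕ} {nBC nv : ℕ} (Gb : BCParam a b n nBC nv)

/-- `B_T B_Q`. -/
def BN (s : ℝ) : Matrix (Fin nBC) (XIdx n) ℝ :=
  Gb.BI s * U1mat n + (matInt s b fun θ => Gb.BI θ * U2mat n * Qmat n (θ - s))
    - Gb.B * Matrix.fromRows (0 : Matrix (CIdx n) (XIdx n) ℝ) (Qmat n (b - s))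

lemma memL2_rows : MemL2Mat a b fun s =>
    Gb.B * Matrix.fromRows (0 : Matrix (CIdx n) (XIdx n) ℝ) (Qmat n (b - s)) :=
  MemL2Mat.const_mul _ (MemL2Mat.fromRows (memL2Mat_of_continuous fun _ _ => continuous_const)
    (memL2Mat_of_continuous (continuous_Qmat_sub b)))

lemma memL2_BI : MemL2Mat a b fun s => Gb.BI s * U1mat n
    + (matInt s b fun θ => Gb.BI θ * U2mat n * Qmat n (θ - s)) :=
  (Gb.BI_mem.mul_const _).add (.of_linf
    (MemLinfMat.volterra_adjoint (Gb.BI_mem.mul_const (U2mat n)) continuous_Qmat))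

lemma memL2_BN : MemL2Mat a b Gb.BN := Gb.memL2_BI.sub Gb.memL2_rows

lemma memL2_BQ : MemL2Mat a b Gb.BQ := Gb.memL2_BN.const_mul (matInv Gb.BT)

/-- Taylor's formula evaluated at `a`, where the remainder is zero, and at `b`. -/
lemma bdry_ofData (c : Vec (CIdx n)) (V : L2 a b (XIdx n)) :
    (Sob.ofData c V).bdry = mv (Matrix.fromRows (Tmat n 0) (Tmat n (b - a))) c
      + intV a b fun θ => mv (Matrix.fromRows (0 : Matrix (CIdx n) (XIdx n) ℝ) (Qmat n (b - θ)))
          (V θ) := by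
  ext (⟨x, j⟩ | ⟨x, j⟩)
  · have h0 : ∀ θ, mv (Matrix.fromRows (0 : Matrix (CIdx n) (XIdx n) ℝ) (Qmat n (b - θ)))
        (V θ) (Sum.inl ⟨x, j⟩) = 0 := fun θ => by simp [mv_apply]
    rw [PiLp.add_apply, intV_apply]
    simp only [h0, intervalIntegral.integral_zero, add_zero]
    change taylorF a c V a ⟨x, j.castSucc⟩ = mv (Tmat n 0) c ⟨x, j⟩
    rw [taylorF_castSucc, taylorC_left, Tmat_zero, one_mv]
  · exact taylorF_castSucc _ _ _ _ _

/-- The boundary conditions, in terms of `(C x̂)(a)` and `D x̂`. -/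
lemma holds_ofData_iff (hab : a ≤ b) (v : Vec (Fin nv)) (c : Vec (CIdx n))
    (V : L2 a b (XIdx n)) : Gb.Holds v (Sob.ofData c V) ↔
      mv Gb.BT c = mv Gb.Bv v + intV a b fun θ => mv (Gb.BN θ) (V θ) := by
  have hT : ∀ i j, Integrable (fun η => (Gb.BI η * U2mat n * Tmat n (η - a)) i j) (vol a b) :=
    ((Gb.BI_mem.mul_const _).mul_continuous (continuous_Tmat_sub a)).integrable
  have hV := Lp.memLp V
  have h1 : intV a b (fun s => mv (Gb.BI s) ((Sob.ofData c V).F s))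
      + mv Gb.Bv v - mv Gb.B (Sob.ofData c V).bdry
      = (mv Gb.Bv v + intV a b fun θ => mv (Gb.BN θ) (V θ)) - mv Gb.BT c := by
    have hrow : ∀ i, Integrable (fun θ => mv (Matrix.fromRows (0 : Matrix (CIdx n) (XIdx n) ℝ)
        (Qmat n (b - θ))) (V θ) i) (vol a b) :=
      (MemL2Mat.fromRows (memL2Mat_of_continuous fun _ _ => continuous_const)
        (memL2Mat_of_continuous (continuous_Qmat_sub b))).mv_integrable hV
    have e : intV a b (fun θ => mv (Gb.BN θ) (V θ))
        = intV a b (fun θ => mv (Gb.BI θ * U1mat n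
            + matInt θ b fun η => Gb.BI η * U2mat n * Qmat n (η - θ)) (V θ))
          - intV a b (fun θ => mv Gb.B (mv (Matrix.fromRows (0 : Matrix (CIdx n) (XIdx n) ℝ)
              (Qmat n (b - θ))) (V θ))) := by
      rw [← intV_sub hab (Gb.memL2_BI.mv_integrable hV)]
      · simp only [BN, sub_mv, mul_mv]
      · intro i
        simpa only [mul_mv] using Gb.memL2_rows.mv_integrable hV i
    have e' : (fun s => mv (Gb.BI s) ((Sob.ofData c V).F s))
        = fun s => mv (Gb.BI s) (taylorF a c V s) := rfl
    rw [bdry_ofData, e, e', intV_mv_taylorF hab Gb.BI_mem c hV, mv_add, mv_intV hab _ hrow, BT,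
      sub_mv, mul_mv]
    abel
  have h2 : Gb.Holds v (Sob.ofData c V) ↔
      intV a b (fun s => mv (Gb.BI s) ((Sob.ofData c V).F s))
        + mv Gb.Bv v - mv Gb.B (Sob.ofData c V).bdry = 0 :=
    ⟨fun h => by ext i; exact h i, fun h i => congrArg (fun x : Vec (Fin nBC) => x i) h⟩
  rw [h2, h1, sub_eq_zero, eq_comm]

/-- The value of `(C x̂)(a)` determined by `v` and `D x̂`. -/
def leftOf (v : Vec (Fin nv)) (V : L2 a b (XIdx n)) : Vec (CIdx n) :=
  mv (matInv Gb.BT * Gb.Bv) v + intV a b fun θ => mv (Gb.BQ θ) (V θ)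

/-- The element `x̂` of `𝒳_v` with `D x̂ = V`. -/
def recon (v : Vec (Fin nv)) (V : L2 a b (XIdx n)) : Sob a b n := Sob.ofData (Gb.leftOf v V) V

variable {Gb} in
lemma holds_ofData_iff_eq (hab : a ≤ b) (hadm : Gb.Admissible) (v : Vec (Fin nv))
    (c : Vec (CIdx n)) (V : L2 a b (XIdx n)) :
    Gb.Holds v (Sob.ofData c V) ↔ c = Gb.leftOf v V := by
  obtain ⟨h1, h2⟩ := matInv_spec hadm
  have e : Gb.leftOf v V
      = mv (matInv Gb.BT) (mv Gb.Bv v + intV a b fun θ => mv (Gb.BN θ) (V θ)) := by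
    rw [mv_add, mv_intV hab _ (Gb.memL2_BN.mv_integrable (Lp.memLp V)), leftOf, mul_mv]
    congr 2
    ext1 θ
    rw [← mul_mv]
    rfl
  rw [holds_ofData_iff _ hab, e]
  constructor
  · intro h
    rw [← h, ← mul_mv, h2, one_mv]
  · rintro rfl
    rw [← mul_mv, h1, one_mv]

lemma Holds.congr (hab : a ≤ b) {v : Vec (Fin nv)} {f g : Sob a b n} (hF : f.F =ᵐ[vol a b] g.F)
    (hb : f.bdry = g.bdry) (h : Gb.Holds v f) : Gb.Holds v g := fun i => by
  rw [← h i, hb]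
  congr 2
  rw [integral_eq_vol hab, integral_eq_vol hab]
  exact integral_congr_ae (hF.mono fun s hs => by simp [hs])

variable {Gb} in
lemma holds_recon (hab : a ≤ b) (hadm : Gb.Admissible) (v : Vec (Fin nv)) (V : L2 a b (XIdx n)) :
    Gb.Holds v (Gb.recon v V) := (holds_ofData_iff_eq hab hadm v _ V).2 rfl

@[simp] lemma top_recon (v : Vec (Fin nv)) (V : L2 a b (XIdx n)) : (Gb.recon v V).top = V :=
  Sob.top_ofData _ _

variable {Gb} in
/-- Every element of `𝒳_v` is recovered from `v` and its highest derivatives. -/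
lemma Holds.eq_recon (hab : a ≤ b) (hadm : Gb.Admissible) {v : Vec (Fin nv)} {f : Sob a b n}
    (h : Gb.Holds v f) :
    f.F =ᵐ[vol a b] (Gb.recon v f.top).F ∧ f.bdry = (Gb.recon v f.top).bdry := by
  obtain ⟨hC, hF⟩ := Sob.eq_of_left_of_top (f := f) (g := Sob.ofData f.left f.top) (by simp)
    (by simp)
  have hb := Sob.bdry_eq hab hC
  have hl := (holds_ofData_iff_eq hab hadm _ _ _).1 (Holds.congr Gb hab hF hb h)
  rw [recon, ← hl]
  exact ⟨hF, hb⟩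

/-- Each of the rows `T₁(s-a)`, `U₂ T(s-a)` and `T(b-a)` acts on the reconstructed `c` in this way,
producing the `B_v` and `B_Q` terms in the PI parameters. -/
lemma mv_leftOf (hab : a ≤ b) {m : Type} (M : Matrix m (CIdx n) ℝ) (v : Vec (Fin nv))
    (V : L2 a b (XIdx n)) : mv M (Gb.leftOf v V)
      = mv (M * (matInv Gb.BT * Gb.Bv)) v + intV a b fun θ => mv (M * Gb.BQ θ) (V θ) := by
  rw [leftOf, mv_add, mv_intV hab _ (Gb.memL2_BQ.mv_integrable (Lp.memLp V)), mul_mv M]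
  simp only [mul_mv M]

/-- The class of `F x̂` as a continuous linear function of `v` and `D x̂`. -/
def reconL : (Vec (Fin nv) × L2 a b (XIdx n)) →L[ℝ] L2 a b (FIdx n) :=
  (jetL a b n).comp (((mvL (matInv Gb.BT * Gb.Bv)).comp (ContinuousLinearMap.fst ℝ _ _)
    + (kernelL Gb.memL2_BQ).comp (ContinuousLinearMap.snd ℝ _ _)).prod
      (ContinuousLinearMap.snd ℝ _ _))

lemma jet_recon (hab : a ≤ b) (v : Vec (Fin nv)) (V : L2 a b (XIdx n)) :
    (Gb.recon v V).jet = Gb.reconL (v, V) := by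
  rw [recon, Sob.jet_ofData, leftOf, ← kernelL_apply hab Gb.memL2_BQ]
  rfl

end BCParam

/-! ### The PI operators in terms of the reconstruction -/

section Operators

variable {N : ℕ} {a b : ℝ} {n : Fin (N + 1) → ℕ} {nBC nv nr : ℕ} (Gb : BCParam a b n nBC nv)

/-- `R_{D,1}` and `R_{D,2}` share the term `U₂ T(η-a) B_Q(θ)`. Its integrals over the two sides join
to one over `[a, b]`, from which `B_Q(θ)` factors out; only the `Q` term stays one-sided. -/
lemma matInt_RD (hab : a ≤ b) {m : Type} {k : ℝ → Matrix m (FIdx n) ℝ} (hk : MemL2Mat a b k)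
    {θ : ℝ} (hθ : θ ∈ Icc a b) :
    (matInt θ b fun η => k η * Gb.RD1 η θ) + (matInt a θ fun η => k η * Gb.RD2 η θ)
      = (matInt a b fun η => k η * U2mat n * Tmat n (η - a)) * Gb.BQ θ
        + matInt θ b fun η => k η * U2mat n * Qmat n (η - θ) := by
  have hT : MemL2Mat a b fun η => k η * U2mat n * Tmat n (η - a) :=
    (hk.mul_const _).mul_continuous (continuous_Tmat_sub a)
  have hTB := hT.mul_const (Gb.BQ θ)
  have hQ : MemL2Mat a b fun η => k η * U2mat n * Qmat n (η - θ) :=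
    (hk.mul_const _).mul_continuous fun i j => (continuous_Qmat i j).comp (by fun_prop)
  have e1 : (fun η => k η * Gb.RD1 η θ) = fun η =>
      k η * U2mat n * Tmat n (η - a) * Gb.BQ θ + k η * U2mat n * Qmat n (η - θ) := by
    ext1 η
    simp only [BCParam.RD1, BCParam.RD2, Matrix.mul_add, Matrix.mul_assoc]
  have e2 : (fun η => k η * Gb.RD2 η θ) = fun η => k η * U2mat n * Tmat n (η - a) * Gb.BQ θ := by
    ext1 η
    simp only [BCParam.RD2, Matrix.mul_assoc]
  rw [e1, e2, matInt_add hθ.2 (fun i j => (hTB.integrable i j).mono_measure (vol_le_right hθ))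
    (fun i j => (hQ.integrable i j).mono_measure (vol_le_right hθ)), add_right_comm,
    add_comm (matInt θ b _), matInt_split hθ hTB.integrable, matInt_mul_const hab hT.integrable]

/-- After `matInt_RD` the integral part is a constant matrix times `B_Q` plus a bounded Volterra
adjoint. -/
lemma memL2_kernel (hab : a ≤ b) {m : Type} {k : ℝ → Matrix m (FIdx n) ℝ} (hk : MemL2Mat a b k) :
    MemL2Mat a b fun θ => k θ * U1mat n + ((matInt θ b fun η => k η * Gb.RD1 η θ)
      + (matInt a θ fun η => k η * Gb.RD2 η θ)) := by
  refine (hk.mul_const _).add (MemL2Mat.congr_Icc ?_ fun θ hθ => (matInt_RD Gb hab hk hθ).symm)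
  exact (Gb.memL2_BQ.const_mul _).add (.of_linf
    (MemLinfMat.volterra_adjoint (hk.mul_const (U2mat n)) continuous_Qmat))

/-- Integrating a matrix function against the reconstructed derivatives of an element of
`𝒳_v`. -/
lemma intV_mv_recon (hab : a ≤ b) {m : Type} {k : ℝ → Matrix m (FIdx n) ℝ} (hk : MemL2Mat a b k)
    (v : Vec (Fin nv)) (V : L2 a b (XIdx n)) :
    intV a b (fun η => mv (k η) ((Gb.recon v V).F η))
      = mv (matInt a b fun η => k η * Gb.Upsilon.Q2 η) v
        + intV a b fun θ => mv (k θ * U1mat n + ((matInt θ b fun η => k η * Gb.RD1 η θ)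
            + (matInt a θ fun η => k η * Gb.RD2 η θ))) (V θ) := by
  have hV := Lp.memLp V
  have hT : MemL2Mat a b fun η => k η * U2mat n * Tmat n (η - a) :=
    (hk.mul_const _).mul_continuous (continuous_Tmat_sub a)
  have hQ := (hk.mul_const (U1mat n)).add (MemL2Mat.of_linf
    (MemLinfMat.volterra_adjoint (hk.mul_const (U2mat n)) continuous_Qmat))
  have e : (fun η => mv (k η) ((Gb.recon v V).F η))
      = fun η => mv (k η) (taylorF a (Gb.leftOf v V) V η) := rfl
  have e2 : (fun η => k η * Gb.Upsilon.Q2 η)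
      = fun η => k η * U2mat n * Tmat n (η - a) * (matInv Gb.BT * Gb.Bv) := by
    ext1 η
    simp only [BCParam.Upsilon, Matrix.mul_assoc]
  rw [e, intV_mv_taylorF hab hk _ hV, Gb.mv_leftOf hab, e2, matInt_mul_const hab hT.integrable,
    add_assoc, ← intV_add hab ((Gb.memL2_BQ.const_mul _).mv_integrable hV)
      (hQ.mv_integrable hV)]
  congr 1
  refine intV_congr_Icc hab fun θ hθ => ?_
  rw [← add_mv, matInt_RD Gb hab hk hθ]
  congr 1
  abel

lemma memL2_RD (s : ℝ) :
    MemL2Mat a b fun θ => if θ < s then Gb.RD1 s θ else Gb.RD2 s θ :=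
  have h : MemL2Mat a b fun θ => Gb.RD2 s θ := Gb.memL2_BQ.const_mul _
  (h.add (.const_mul _ (memL2Mat_of_continuous (continuous_Qmat_sub s)))).ite_lt h s

/-- The distributed part of `𝒫[Υ]`, with its two kernels glued along the diagonal. -/
lemma recon_F {s : ℝ} (hs : s ∈ Icc a b) (v : Vec (Fin nv)) (V : L2 a b (XIdx n)) :
    (Gb.recon v V).F s = mv (Gb.Upsilon.Q2 s) v + mv (U1mat n) (V s)
      + intV a b fun θ => mv (if θ < s then Gb.RD1 s θ else Gb.RD2 s θ) (V θ) := by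
  have hab := hs.1.trans hs.2
  have hV := Lp.memLp V
  have e : (Gb.recon v V).F s = mv (U1mat n) (V s) + (mv (U2mat n * Tmat n (s - a)) (Gb.leftOf v V)
      + mv (U2mat n) (intV a s fun θ => mv (Qmat n (s - θ)) (V θ))) := by
    rw [mul_mv, ← mv_add]; rfl
  have hB : ∀ i, Integrable (fun θ => mv (U2mat n * Tmat n (s - a) * Gb.BQ θ) (V θ) i) (vol a b) :=
    (Gb.memL2_BQ.const_mul (U2mat n * Tmat n (s - a))).mv_integrable hV
  have hQ : MemL2Mat a b fun θ => U2mat n * Qmat n (s - θ) :=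
    .const_mul _ (memL2Mat_of_continuous (continuous_Qmat_sub s))
  rw [e, Gb.mv_leftOf hab, mv_intV hs.1 _ (integrable_Qmat_mv hV hs),
    ← intV_ite hs ((memL2_RD Gb s).mv_integrable hV)
    (f := fun θ => mv (U2mat n * Tmat n (s - a) * Gb.BQ θ) (V θ)
      + mv (U2mat n) (mv (Qmat n (s - θ)) (V θ)))
    (g := fun θ => mv (U2mat n * Tmat n (s - a) * Gb.BQ θ) (V θ)) ?_ ?_,
    intV_add hs.1 (fun i => (hB i).mono_measure (vol_le_left hs)), ← intV_split hs hB]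
  · simp only [BCParam.Upsilon, Matrix.mul_assoc]
    abel
  · intro i
    simpa only [mul_mv] using (hQ.mv_integrable hV i).mono_measure (vol_le_left hs)
  · intro θ hθ
    simp only [hθ.2, if_true, BCParam.RD1, BCParam.RD2, add_mv, mul_mv]
  · intro θ hθ
    simp only [hθ.1.not_gt, if_false, BCParam.RD2]

lemma memL2_UpsilonQ1 : MemL2Mat a b Gb.Upsilon.Q1 :=
  .fromRows (memL2Mat_of_continuous fun _ _ => continuous_const)
    (.fromRows Gb.memL2_BQ ((Gb.memL2_BQ.const_mul _).add
      (memL2Mat_of_continuous (continuous_Qmat_sub b))))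

/-- The finite-dimensional part of `𝒫[Υ]`: its three blocks are `v`, the boundary values at `a`, and
those at `b`. -/
lemma elim_bdry_recon (hab : a ≤ b) (v : Vec (Fin nv)) (V : L2 a b (XIdx n)) :
    (WithLp.toLp 2 (Sum.elim v (Gb.recon v V).bdry) : Vec (Fin nv ⊕ BIdx n))
      = mv Gb.Upsilon.P v + intV a b fun θ => mv (Gb.Upsilon.Q1 θ) (V θ) := by
  have hV := Lp.memLp V
  have hB : mv (Tmat n (b - a)) (Gb.leftOf v V) + intV a b (fun θ => mv (Qmat n (b - θ)) (V θ))
      = mv (Tmat n (b - a) * (matInv Gb.BT * Gb.Bv)) v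
        + intV a b fun θ => mv (Tmat n (b - a) * Gb.BQ θ + Qmat n (b - θ)) (V θ) := by
    rw [Gb.mv_leftOf hab, add_assoc,
      ← intV_add hab ((Gb.memL2_BQ.const_mul (Tmat n (b - a))).mv_integrable hV)
        ((memL2Mat_of_continuous (continuous_Qmat_sub b)).mv_integrable hV)]
    simp only [add_mv]
  ext (i | ⟨x, j⟩ | ⟨x, j⟩)
  · have h0 : ∀ θ, mv (Gb.Upsilon.Q1 θ) (V θ) (Sum.inl i) = 0 := fun θ => by
      simp [mv_apply, BCParam.Upsilon]
    rw [PiLp.add_apply, intV_apply]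
    simp only [h0, intervalIntegral.integral_zero, add_zero]
    change v i = mv (1 : Matrix (Fin nv) (Fin nv) ℝ) v i
    rw [one_mv]
  · change taylorF a (Gb.leftOf v V) V a ⟨x, j.castSucc⟩ = Gb.leftOf v V ⟨x, j⟩
    rw [taylorF_castSucc, taylorC_left]
  · change taylorF a (Gb.leftOf v V) V b ⟨x, j.castSucc⟩ = _
    rw [taylorF_castSucc]
    exact congrArg (fun c : Vec (CIdx n) => c ⟨x, j⟩) hB

variable (Gp : PDEParam a b n nv nr)

/-- The finite-dimensional part of the composition `𝒫[Ξ] 𝒫[Υ]` computes the output `r`. -/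
lemma finPart_comp (hab : a ≤ b) (v : Vec (Fin nv)) (V : L2 a b (XIdx n)) :
    (PIParam.comp a b Gp.Xi Gb.Upsilon).finPart a b v V = Gp.out (Gb.recon v V) := by
  have hV := Lp.memLp V
  have hC := MemL2Mat.of_linf Gp.Cr_mem
  have hD := Gb.memL2_BQ
  have e : Gp.out (Gb.recon v V)
      = mv Gp.Xi.P (WithLp.toLp 2 (Sum.elim v (Gb.recon v V).bdry))
        + intV a b fun η => mv (Gp.Cr η) ((Gb.recon v V).F η) := by
    simp only [PDEParam.Xi, mv_fromCols, zero_mv, zero_add]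
    rfl
  have hX : ∀ i, Integrable (fun θ => mv (Gp.Xi.P * Gb.Upsilon.Q1 θ) (V θ) i) (vol a b) :=
    ((memL2_UpsilonQ1 Gb).const_mul Gp.Xi.P).mv_integrable hV
  rw [e, elim_bdry_recon Gb hab, intV_mv_recon Gb hab hC, mv_add,
    mv_intV hab _ ((memL2_UpsilonQ1 Gb).mv_integrable hV)]
  have e2 : (PIParam.comp a b Gp.Xi Gb.Upsilon).finPart a b v V
      = mv (Gp.Xi.P * Gb.Upsilon.P + matInt a b fun s => Gp.Cr s * Gb.Upsilon.Q2 s) v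
        + intV a b fun θ => mv (Gp.Xi.P * Gb.Upsilon.Q1 θ + (Gp.Cr θ * U1mat n
          + ((matInt θ b fun η => Gp.Cr η * Gb.RD1 η θ)
            + (matInt a θ fun η => Gp.Cr η * Gb.RD2 η θ)))) (V θ) := by
    simp only [← add_assoc]
    rfl
  have e3 : intV a b (fun θ => mv (Gp.Xi.P * Gb.Upsilon.Q1 θ + (Gp.Cr θ * U1mat n
          + ((matInt θ b fun η => Gp.Cr η * Gb.RD1 η θ)
            + (matInt a θ fun η => Gp.Cr η * Gb.RD2 η θ)))) (V θ))
      = intV a b (fun θ => mv (Gp.Xi.P * Gb.Upsilon.Q1 θ) (V θ))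
        + intV a b (fun θ => mv (Gp.Cr θ * U1mat n
          + ((matInt θ b fun η => Gp.Cr η * Gb.RD1 η θ)
            + (matInt a θ fun η => Gp.Cr η * Gb.RD2 η θ))) (V θ)) := by
    rw [← intV_add hab hX ((memL2_kernel Gb hab hC).mv_integrable hV)]
    simp only [add_mv]
  rw [e2, e3, add_mv]
  simp only [mul_mv Gp.Xi.P]
  abel

/-- For fixed `s` the factor `F(s)ᵀ` is a constant matrix, so the slice inherits the boundedness of
`G`. -/
lemma SeparableKernel.memL2 {m k : Type} {R : ℝ → ℝ → Matrix m k ℝ} (hR : SeparableKernel a b R)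
    {s : ℝ} (hs : s ∈ Icc a b) : MemL2Mat a b (R s) := by
  obtain ⟨r, F, G, -, hG, h⟩ := hR
  exact ((MemL2Mat.of_linf hG).const_mul (F s)ᵀ).congr_Icc fun θ hθ => (h s hs θ hθ).symm

/-- The distributed part of the composition `𝒫[Ξ] 𝒫[Υ]` computes the right-hand side of the
in-domain dynamics. -/
lemma distPart_comp (v : Vec (Fin nv)) (V : L2 a b (XIdx n)) {s : ℝ} (hs : s ∈ Icc a b) :
    (PIParam.comp a b Gp.Xi Gb.Upsilon).distPart a b v V s = Gp.rhs (Gb.recon v V) v s := by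
  have hab := hs.1.trans hs.2
  have hV := Lp.memLp V
  have hA1 := Gp.A1_sep.memL2 hs
  have hA2 := Gp.A2_sep.memL2 hs
  -- For fixed `s` the kernels `A₁`, `A₂` are glued into one, so that `intV_mv_recon` yields the
  -- composed kernel `W` in one stroke. The identities `r1` and `r2` below match it with the
  -- composition formula on either side of the diagonal.
  set k : ℝ → Matrix (XIdx n) (FIdx n) ℝ := fun η => if η < s then Gp.A1 s η else Gp.A2 s η with hk'
  have hk : MemL2Mat a b k := hA1.ite_lt hA2 s
  have hk1 : ∀ η, η < s → k η = Gp.A1 s η := fun η h => if_pos h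
  have hk2 : ∀ η, ¬ η < s → k η = Gp.A2 s η := fun η h => if_neg h
  have hF : MemLp (Gb.recon v V).F 2 (vol a b) := (Gb.recon v V).memLp
  set F := (Gb.recon v V).F with hFdef
  have hQ1 := memL2_UpsilonQ1 Gb
  have e : Gp.rhs (Gb.recon v V) v s
      = mv (Gp.A0 s) (F s) + mv (Gp.Xi.Q2 s) (WithLp.toLp 2 (Sum.elim v (Gb.recon v V).bdry))
        + intV a b fun η => mv (k η) (F η) := by
    rw [← intV_ite hs (hk.mv_integrable hF) (f := fun η => mv (Gp.A1 s η) (F η))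
      (g := fun η => mv (Gp.A2 s η) (F η)) (fun θ hθ => by rw [hk1 θ hθ.2])
      (fun θ hθ => by rw [hk2 θ hθ.1.not_gt])]
    simp only [PDEParam.Xi, mv_fromCols, PDEParam.rhs, ← add_assoc]
    rfl
  have hL := memL2_RD Gb s
  have hK1 := hQ1.const_mul (Gp.Xi.Q2 s)
  have hK2 := hL.const_mul (Gp.A0 s)
  have hK3 := memL2_kernel Gb hab hk
  set W : ℝ → Matrix (XIdx n) (XIdx n) ℝ := fun θ => k θ * U1mat n
    + ((matInt θ b fun η => k η * Gb.RD1 η θ) + (matInt a θ fun η => k η * Gb.RD2 η θ)) with hW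
  have e1 : Gp.rhs (Gb.recon v V) v s
      = mv (Gp.Xi.Q2 s * Gb.Upsilon.P + Gp.A0 s * Gb.Upsilon.Q2 s
          + matInt a b fun η => k η * Gb.Upsilon.Q2 η) v
        + mv (Gp.A0 s * U1mat n) (V s)
        + intV a b fun θ => mv (Gp.Xi.Q2 s * Gb.Upsilon.Q1 θ
          + Gp.A0 s * (if θ < s then Gb.RD1 s θ else Gb.RD2 s θ) + W θ) (V θ) := by
    have i1 := hK1.mv_integrable hV
    have i2 := hK2.mv_integrable hV
    have i3 := hK3.mv_integrable hV
    have h3 : intV a b (fun θ => mv (Gp.Xi.Q2 s * Gb.Upsilon.Q1 θ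
          + Gp.A0 s * (if θ < s then Gb.RD1 s θ else Gb.RD2 s θ) + W θ) (V θ))
        = intV a b (fun θ => mv (Gp.Xi.Q2 s * Gb.Upsilon.Q1 θ) (V θ))
          + intV a b (fun θ => mv (Gp.A0 s * (if θ < s then Gb.RD1 s θ else Gb.RD2 s θ)) (V θ))
          + intV a b (fun θ => mv (W θ) (V θ)) := by
      rw [← intV_add hab i1 i2, ← intV_add hab (fun i => (i1 i).add (i2 i)) i3]
      simp only [add_mv]
    have h4 : intV a b (fun η => mv (k η) ((Gb.recon v V).F η))
        = mv (matInt a b fun η => k η * Gb.Upsilon.Q2 η) v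
          + intV a b fun θ => mv (W θ) (V θ) := intV_mv_recon Gb hab hk v V
    rw [e, hFdef, h4, elim_bdry_recon Gb hab, recon_F Gb hs, h3, mv_add, mv_add,
      mv_add, mv_intV hab _ (hL.mv_integrable hV), mv_intV hab _ (hQ1.mv_integrable hV)]
    simp only [add_mv, mul_mv (Gp.A0 s), mul_mv (Gp.Xi.Q2 s)]
    abel
  have hQ2 : MemL2Mat a b fun η => k η * Gb.Upsilon.Q2 η := by
    have : (fun η => k η * Gb.Upsilon.Q2 η)
        = fun η => k η * U2mat n * Tmat n (η - a) * (matInv Gb.BT * Gb.Bv) := by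
      ext1 η
      simp only [BCParam.Upsilon, Matrix.mul_assoc]
    rw [this]
    exact ((hk.mul_const _).mul_continuous (continuous_Tmat_sub a)).mul_const _
  have hkR : ∀ θ, (MemL2Mat a b fun η => k η * Gb.RD1 η θ)
      ∧ MemL2Mat a b fun η => k η * Gb.RD2 η θ := fun θ => by
    have hT := ((hk.mul_const (U2mat n)).mul_continuous (continuous_Tmat_sub a)).mul_const
      (Gb.BQ θ)
    have hQ : MemL2Mat a b fun η => k η * U2mat n * Qmat n (η - θ) :=
      (hk.mul_const _).mul_continuous fun i j => (continuous_Qmat i j).comp (by fun_prop)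
    constructor
    · refine (hT.add hQ).congr_Icc fun η _ => ?_
      simp only [BCParam.RD1, BCParam.RD2, Matrix.mul_add, Matrix.mul_assoc]
    · refine hT.congr_Icc fun η _ => ?_
      simp only [BCParam.RD2, Matrix.mul_assoc]
  have restrict : ∀ {M : ℝ → Matrix (XIdx n) (XIdx n) ℝ}, MemL2Mat a b M → ∀ {c d : ℝ},
      Icc c d ⊆ Icc a b → ∀ i j, Integrable (fun η => M η i j) (vol c d) :=
    fun {M} hM {c d} hcd i j => (hM.integrable i j).mono_measure (Measure.restrict_mono hcd le_rfl)
  have q2 : (matInt a s fun η => Gp.A1 s η * Gb.Upsilon.Q2 η)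
      + (matInt s b fun η => Gp.A2 s η * Gb.Upsilon.Q2 η)
      = matInt a b fun η => k η * Gb.Upsilon.Q2 η := by
    rw [← matInt_split hs hQ2.integrable]
    congr 1
    · exact matInt_congr_Ioo hs.1 fun η hη => by rw [hk1 η hη.2]
    · exact matInt_congr_Ioo hs.2 fun η hη => by rw [hk2 η hη.1.not_gt]
  have r1 : ∀ θ ∈ Ioo a s, (PIParam.comp a b Gp.Xi Gb.Upsilon).R1 s θ
      = Gp.Xi.Q2 s * Gb.Upsilon.Q1 θ
        + Gp.A0 s * (if θ < s then Gb.RD1 s θ else Gb.RD2 s θ) + W θ := fun θ hθ => by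
    have h1 : (matInt a θ fun η => Gp.A1 s η * Gb.RD2 η θ)
        = matInt a θ fun η => k η * Gb.RD2 η θ :=
      matInt_congr_Ioo hθ.1.le fun η hη => by rw [hk1 η (hη.2.trans hθ.2)]
    have h2 : (matInt θ s fun η => Gp.A1 s η * Gb.RD1 η θ)
        = matInt θ s fun η => k η * Gb.RD1 η θ :=
      matInt_congr_Ioo hθ.2.le fun η hη => by rw [hk1 η hη.2]
    have h3 : (matInt s b fun η => Gp.A2 s η * Gb.RD1 η θ)
        = matInt s b fun η => k η * Gb.RD1 η θ :=
      matInt_congr_Ioo hs.2 fun η hη => by rw [hk2 η hη.1.not_gt]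
    -- The composition formula splits at both `θ` and `s`, whereas `W` splits only at `θ`; the
    -- integral of `k R_{D,1}` over `[θ, b]` is therefore cut at `s`.
    have h4 := matInt_split (a := θ) (b := b) (s := s) ⟨hθ.2.le, hs.2⟩
      (restrict (hkR θ).1 (Icc_subset_Icc hθ.1.le le_rfl))
    rw [if_pos hθ.2, hW]
    dsimp only
    rw [← h4, hk1 θ hθ.2, ← h1, ← h2, ← h3]
    simp only [PIParam.comp, PDEParam.Xi, BCParam.Upsilon]
    abel
  have r2 : ∀ θ ∈ Ioo s b, (PIParam.comp a b Gp.Xi Gb.Upsilon).R2 s θ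
      = Gp.Xi.Q2 s * Gb.Upsilon.Q1 θ
        + Gp.A0 s * (if θ < s then Gb.RD1 s θ else Gb.RD2 s θ) + W θ := fun θ hθ => by
    have h1 : (matInt a s fun η => Gp.A1 s η * Gb.RD2 η θ)
        = matInt a s fun η => k η * Gb.RD2 η θ :=
      matInt_congr_Ioo hs.1 fun η hη => by rw [hk1 η hη.2]
    have h2 : (matInt s θ fun η => Gp.A2 s η * Gb.RD2 η θ)
        = matInt s θ fun η => k η * Gb.RD2 η θ :=
      matInt_congr_Ioo hθ.1.le fun η hη => by rw [hk2 η hη.1.not_gt]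
    have h3 : (matInt θ b fun η => Gp.A2 s η * Gb.RD1 η θ)
        = matInt θ b fun η => k η * Gb.RD1 η θ :=
      matInt_congr_Ioo hθ.2.le fun η hη => by rw [hk2 η (hθ.1.trans hη.1).not_gt]
    have h4 := matInt_split (a := a) (b := θ) (s := s) ⟨hs.1, hθ.1.le⟩
      (restrict (hkR θ).2 (Icc_subset_Icc le_rfl hθ.2.le))
    rw [if_neg hθ.1.not_gt, hW]
    dsimp only
    rw [← h4, hk2 θ hθ.1.not_gt, ← h1, ← h2, ← h3]
    simp only [PIParam.comp, PDEParam.Xi, BCParam.Upsilon]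
    abel
  have e2 : (PIParam.comp a b Gp.Xi Gb.Upsilon).distPart a b v V s
      = mv (Gp.Xi.Q2 s * Gb.Upsilon.P + Gp.A0 s * Gb.Upsilon.Q2 s
          + (matInt a s fun η => Gp.A1 s η * Gb.Upsilon.Q2 η)
          + (matInt s b fun η => Gp.A2 s η * Gb.Upsilon.Q2 η)) v
        + mv (Gp.A0 s * U1mat n) (V s)
        + (intV a s (fun θ => mv ((PIParam.comp a b Gp.Xi Gb.Upsilon).R1 s θ) (V θ))
        + intV s b (fun θ => mv ((PIParam.comp a b Gp.Xi Gb.Upsilon).R2 s θ) (V θ))) := by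
    rw [← add_assoc]
    rfl
  rw [e1, e2, add_assoc (Gp.Xi.Q2 s * Gb.Upsilon.P + _), q2,
    intV_ite hs (((hK1.add hK2).add hK3).mv_integrable hV)
      (fun θ hθ => by rw [r1 θ hθ]) (fun θ hθ => by rw [r2 θ hθ])]

/-! ### The operator `𝒯` as reconstruction of the PDE state -/

lemma G0mat_mv (v : Vec (XIdx n)) (x : XIdx n) :
    mv (G0mat n) v x = if (x.1 : ℕ) = 0 then v x else 0 := by
  rw [mv_apply, Finset.sum_eq_single x]
  · simp [G0mat]
  · intro y _ hy
    simp [G0mat, hy.symm]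
  · simp

lemma Q1mat_mv (s : ℝ) (v : Vec (XIdx n)) (x : XIdx n) :
    mv (Q1mat n s) v x = if 0 < (x.1 : ℕ) then tau ((x.1 : ℕ) - 1) s * v x else 0 := by
  rw [mv_apply, Finset.sum_eq_single x]
  · simp [Q1mat]
  · intro y _ hy
    simp [Q1mat, hy.symm]
  · simp

lemma T1mat_mv (s : ℝ) (c : Vec (CIdx n)) (x : XIdx n) :
    mv (T1mat n s) c x = ∑ k : Fin (x.1 : ℕ), tau k s * c ⟨x, k⟩ := by
  rw [mv_apply, Fintype.sum_sigma, Finset.sum_eq_single x]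
  · simp [T1mat]
  · intro y _ hy
    exact Finset.sum_eq_zero fun k _ => by simp [T1mat, hy.symm]
  · simp

/-- For an entry of `x̂₀` the derivative of order zero is the highest one and `G₀` returns it; for
the others Taylor's formula applies. This accounts for the zero rows in `T₁` and `Q₁`. -/
lemma taylorF_zero (c : Vec (CIdx n)) (v : ℝ → Vec (XIdx n)) (s : ℝ) :
    (WithLp.toLp 2 fun x => taylorF a c v s ⟨x, 0⟩ : Vec (XIdx n))
      = mv (G0mat n) (v s) + mv (T1mat n (s - a)) c
        + intV a s fun θ => mv (Q1mat n (s - θ)) (v θ) := by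
  ext x
  simp only [PiLp.add_apply, G0mat_mv, T1mat_mv, intV_apply, Q1mat_mv]
  rcases Nat.eq_zero_or_pos (x.1 : ℕ) with h | h
  · have h0 : (0 : Fin ((x.1 : ℕ) + 1)) = Fin.last _ := Fin.ext h.symm
    have : IsEmpty (Fin (x.1 : ℕ)) := by rw [h]; infer_instance
    rw [h0, taylorF_last]
    simp [h]
  · have h0 : (0 : Fin ((x.1 : ℕ) + 1)) = Fin.castSucc ⟨0, h⟩ := Fin.ext rfl
    rw [h0, taylorF_castSucc, taylorC_apply]
    simp [h, h.ne']

lemma Q1mat_memL2 (s : ℝ) : MemL2Mat a b fun θ => Q1mat n (s - θ) :=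
  memL2Mat_of_continuous fun i j => by
    simp only [Q1mat, Matrix.of_apply]
    split_ifs
    · exact (continuous_tau _).comp (by fun_prop)
    · exact continuous_const

/-- The distributed part of `𝒯` reconstructs the PDE state. -/
lemma state_recon {s : ℝ} (hs : s ∈ Icc a b) (v : Vec (Fin nv)) (V : L2 a b (XIdx n)) :
    (WithLp.toLp 2 fun x => (Gb.recon v V).F s ⟨x, 0⟩ : Vec (XIdx n))
      = mv (Gb.Gv s) v + mv (G0mat n) (V s) + intV a s (fun θ => mv (Gb.G1 s θ) (V θ))
        + intV s b (fun θ => mv (Gb.G2 s θ) (V θ)) := by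
  have hab := hs.1.trans hs.2
  have hV := Lp.memLp V
  have hG2 : ∀ i, Integrable (fun θ => mv (Gb.G2 s θ) (V θ) i) (vol a b) :=
    (Gb.memL2_BQ.const_mul (T1mat n (s - a))).mv_integrable hV
  have h1 : intV a s (fun θ => mv (Gb.G1 s θ) (V θ))
      = intV a s (fun θ => mv (Q1mat n (s - θ)) (V θ)) + intV a s fun θ => mv (Gb.G2 s θ) (V θ) := by
    rw [← intV_add hs.1
      (fun i => ((Q1mat_memL2 s).mv_integrable hV i).mono_measure (vol_le_left hs))
      (fun i => (hG2 i).mono_measure (vol_le_left hs))]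
    simp only [BCParam.G1, add_mv]
  have h2 : mv (T1mat n (s - a)) (Gb.leftOf v V)
      = mv (Gb.Gv s) v + intV a b fun θ => mv (Gb.G2 s θ) (V θ) := Gb.mv_leftOf hab _ v V
  change (WithLp.toLp 2 fun x => taylorF a (Gb.leftOf v V) V s ⟨x, 0⟩ : Vec (XIdx n)) = _
  rw [taylorF_zero, h1, h2, ← intV_split hs hG2]
  abel

end Operators

/-! ### Functions of time -/

section Time

variable {E F : Type} [NormedAddCommGroup E] [NormedAddCommGroup F]

lemma L2e.clm [NormedSpace ℝ E] [NormedSpace ℝ F] {f : ℝ → E} (hf : L2e f) (L : E →L[ℝ] F) :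
    L2e fun t => L (f t) :=
  fun τ => L.comp_memLp' (hf τ)

lemma L2e.add {f g : ℝ → E} (hf : L2e f) (hg : L2e g) : L2e fun t => f t + g t :=
  fun τ => (hf τ).add (hg τ)

lemma L2e_zero : L2e (0 : ℝ → E) := fun _ => MemLp.zero

lemma L2e.congr {f g : ℝ → E} (hf : L2e f) (h : ∀ t, 0 ≤ t → f t = g t) : L2e g := fun τ =>
  (memLp_congr_ae ((ae_restrict_iff' measurableSet_Icc).2
    (Filter.Eventually.of_forall fun t ht => h t ht.1))).1 (hf τ)

lemma W1e_zero [NormedSpace ℝ E] : W1e fun _ : ℝ => (0 : E) := ⟨0, L2e_zero, fun t _ => by simp⟩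

/-- `g` is compared with `L ∘ f` only at times `t ≥ 0`, as the domain conditions hold only there.
Using `‖L‖ + 1` avoids division by zero. -/
lemma LocAC.clm [NormedSpace ℝ E] [NormedSpace ℝ F] {f : ℝ → E} (hf : LocAC f) (L : E →L[ℝ] F)
    {g : ℝ → F}
    (hg : ∀ t, 0 ≤ t → g t = L (f t)) : LocAC g := fun τ hτ => by
  have h := (absolutelyContinuousOnInterval_iff f 0 τ).1 (hf τ hτ)
  refine (absolutelyContinuousOnInterval_iff g 0 τ).2 fun ε hε => ?_
  have hpos : 0 < ‖L‖ + 1 := by positivity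
  obtain ⟨δ, hδ, H⟩ := h (ε / (‖L‖ + 1)) (by positivity)
  refine ⟨δ, hδ, fun I hI hlt => ?_⟩
  have hI' := hI.1
  refine lt_of_le_of_lt ?_ ((lt_div_iff₀' hpos).1 (H I hI hlt))
  rw [Finset.mul_sum]
  refine Finset.sum_le_sum fun i hi => ?_
  have h1 := hI' i hi
  rw [uIcc_of_le hτ] at h1
  rw [hg _ h1.1.1, hg _ h1.2.1, dist_eq_norm, dist_eq_norm, ← map_sub]
  exact (L.le_opNorm _).trans (mul_le_mul_of_nonneg_right (by linarith) (norm_nonneg _))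

lemma LocAC.add {f g : ℝ → E} (hf : LocAC f) (hg : LocAC g) : LocAC fun t => f t + g t :=
  fun τ hτ => (hf τ hτ).fun_add (hg τ hτ)

lemma LocAC.l2e {f : ℝ → E} (hf : LocAC f) : L2e f := fun τ => by
  rcases lt_or_ge τ 0 with hτ | hτ
  · simp [Icc_eq_empty hτ.not_ge]
  · have hc := (hf τ hτ).continuousOn
    rw [uIcc_of_le hτ] at hc
    obtain ⟨C, hC⟩ := isCompact_Icc.exists_bound_of_continuousOn hc
    exact MemLp.of_bound (hc.aestronglyMeasurable_of_isCompact isCompact_Icc measurableSet_Icc) C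
      ((ae_restrict_iff' measurableSet_Icc).2 (Filter.Eventually.of_forall hC))

lemma hasDerivAt_toLp [NormedSpace ℝ E] [NormedSpace ℝ F] {x : ℝ → E} {s : ℝ → F} {x' : E}
    {s' : F} {t : ℝ} (hx : HasDerivAt x x' t) (hs : HasDerivAt s s' t) :
    HasDerivAt (fun τ => WithLp.toLp 2 (x τ, s τ)) (WithLp.toLp 2 (x', s')) t :=
  (WithLp.prodContinuousLinearEquiv 2 ℝ E F).symm.hasFDerivAt.comp_hasDerivAt t (hx.prodMk hs)

/-- At `t > 0` the domain condition holds on a neighbourhood of `t`, as a two-sided derivative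
requires. -/
lemma ae_pos : ∀ᵐ t ∂(volume.restrict (Ici (0 : ℝ))), 0 < t := by
  rw [← restrict_Ioi_eq_restrict_Ici]
  exact ae_restrict_mem measurableSet_Ioi

end Time

/-! ### PI operators at zero -/

lemma PIParam.op_zero {m p n q : Type} [Fintype m] [Fintype p] [Fintype n] [Fintype q] {a b : ℝ}
    (hab : a ≤ b) (K : PIParam m p n q) : K.op a b 0 = 0 := by
  have h0 : ((0 : L2 a b q) : ℝ → Vec q) =ᵐ[vol a b] fun _ => 0 := Lp.coeFn_zero _ _ _
  have key : ∀ {k : Type} (M : ℝ → Matrix k q ℝ) {c d : ℝ}, c ≤ d → Icc c d ⊆ Icc a b →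
      intV c d (fun θ => mv (M θ) ((0 : L2 a b q) θ)) = 0 := fun M c d hcd hsub => by
    rw [intV_congr hcd (g := fun _ => 0)
      (Filter.Eventually.mono (ae_mono (Measure.restrict_mono hsub le_rfl) h0)
        fun θ hθ => by dsimp only; rw [hθ, mv_zero])]
    ext i
    simp [intV_apply]
  have hf : K.finPart a b 0 (0 : L2 a b q) = 0 := by
    change mv K.P 0 + intV a b (fun θ => mv (K.Q1 θ) ((0 : L2 a b q) θ)) = 0
    rw [key _ hab le_rfl, mv_zero, add_zero]
  have hd : K.distPart a b 0 (0 : L2 a b q) =ᵐ[vol a b] fun _ => 0 := by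
    filter_upwards [h0, ae_restrict_mem measurableSet_Icc] with s h1 hs
    change mv (K.Q2 s) 0 + mv (K.R0 s) ((0 : L2 a b q) s)
      + intV a s (fun θ => mv (K.R1 s θ) ((0 : L2 a b q) θ))
      + intV s b (fun θ => mv (K.R2 s θ) ((0 : L2 a b q) θ)) = 0
    rw [key _ hs.1 (Icc_subset_Icc le_rfl hs.2), key _ hs.2 (Icc_subset_Icc hs.1 le_rfl), h1]
    simp
  have h2 : toL2 a b (fun _ => (0 : Vec p)) = 0 := by
    rw [toL2, dif_pos (MemLp.zero' : MemLp (fun _ => (0 : Vec p)) 2 (vol a b))]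
    exact MemLp.toLp_zero _
  change WithLp.toLp 2 (K.finPart a b 0 (0 : L2 a b q),
    toL2 a b (K.distPart a b 0 (0 : L2 a b q))) = 0
  rw [hf, toL2_congr hd, h2]
  rfl

lemma PIParam.opVec_zero {m p n : Type} [Fintype m] [Fintype p] [Fintype n] {a b : ℝ}
    (hab : a ≤ b) (K : PIParam m p n (Fin 0)) : K.opVec a b 0 = 0 := K.op_zero hab

/-! ### The operators of the associated PIE -/

section Congr

variable {N : ℕ} {a b : ℝ} {n : Fin (N + 1) → ℕ} {nv nr : ℕ} (Gp : PDEParam a b n nv nr)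
  {f g : Sob a b n}

lemma PDEParam.out_congr (hab : a ≤ b) (hF : f.F =ᵐ[vol a b] g.F) (hb : f.bdry = g.bdry) :
    Gp.out f = Gp.out g := by
  have h := intV_congr hab (f := fun θ => mv (Gp.Cr θ) (f.F θ)) (g := fun θ => mv (Gp.Cr θ) (g.F θ))
    (hF.mono fun s hs => by simp [hs])
  change mv Gp.Drb f.bdry + intV a b (fun θ => mv (Gp.Cr θ) (f.F θ)) = _
  rw [h, hb]
  rfl

lemma PDEParam.rhs_congr (hF : f.F =ᵐ[vol a b] g.F) (hb : f.bdry = g.bdry) (v : Vec (Fin nv)) :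
    Gp.rhs f v =ᵐ[vol a b] Gp.rhs g v := by
  filter_upwards [hF, ae_restrict_mem measurableSet_Icc] with s h1 hs
  have e1 := intV_congr hs.1 (f := fun θ => mv (Gp.A1 s θ) (f.F θ))
    (g := fun θ => mv (Gp.A1 s θ) (g.F θ))
    (Filter.Eventually.mono (ae_mono (vol_le_left hs) hF) fun s hs => by simp [hs])
  have e2 := intV_congr hs.2 (f := fun θ => mv (Gp.A2 s θ) (f.F θ))
    (g := fun θ => mv (Gp.A2 s θ) (g.F θ))
    (Filter.Eventually.mono (ae_mono (vol_le_right hs) hF) fun s hs => by simp [hs])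
  change mv (Gp.A0 s) (f.F s) + mv (Gp.Bxv s) v + mv (Gp.Bxb s) f.bdry
    + intV a s (fun θ => mv (Gp.A1 s θ) (f.F θ)) + intV s b (fun θ => mv (Gp.A2 s θ) (f.F θ)) = _
  rw [e1, e2, h1, hb]
  rfl

end Congr

namespace Model

variable {N : ℕ} {a b : ℝ} {n : Fin (N + 1) → ℕ} {nBC nx nw nu nr nz ny nv : ℕ}
  (G : Model a b n nBC nx nw nu nr nz ny nv)

/-- The PDE state reconstructed from a state of the associated PIE. -/
def pdeState (X : RL2 a b (Fin nx) (XIdx n)) : Sob a b n :=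
  G.Gb.recon (mv G.Go.Cv X.fst) X.snd

lemma memL2_subQ1 (hab : a ≤ b) : MemL2Mat a b G.sub.Q1 := by
  refine (((memL2_UpsilonQ1 G.Gb).const_mul G.Gp.Xi.P).add
    (memL2_kernel G.Gb hab (MemL2Mat.of_linf G.Gp.Cr_mem))).congr_Icc fun θ _ => ?_
  simp only [sub, PIParam.comp, PDEParam.Xi, BCParam.Upsilon]
  abel

lemma out_pdeState (hab : a ≤ b) (X : RL2 a b (Fin nx) (XIdx n)) :
    G.Gp.out (G.pdeState X) = mv G.sub.P (mv G.Go.Cv X.fst)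
      + intV a b fun θ => mv (G.sub.Q1 θ) (X.snd θ) :=
  (finPart_comp G.Gb G.Gp hab _ _).symm

/-- The finite-dimensional parts of `𝒜`, `𝒞₁` and `𝒞₂` all have this shape: the output `r` of the
PDE enters through a matrix `M`. -/
lemma mv_add_intV_subQ1 (hab : a ≤ b) {m : ℕ} (A : Matrix (Fin m) (Fin nx) ℝ)
    (M : Matrix (Fin m) (Fin nr) ℝ) (X : RL2 a b (Fin nx) (XIdx n)) :
    mv (A + M * G.sub.P * G.Go.Cv) X.fst + intV a b (fun θ => mv (M * G.sub.Q1 θ) (X.snd θ))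
      = mv A X.fst + mv M (G.Gp.out (G.pdeState X)) := by
  rw [out_pdeState G hab, mv_add,
    mv_intV hab _ ((G.memL2_subQ1 hab).mv_integrable (Lp.memLp X.snd)), add_mv]
  simp only [mul_mv, add_assoc]

lemma toPIE_T_op (X : RL2 a b (Fin nx) (XIdx n)) :
    G.toPIE.T.op a b X = WithLp.toLp 2 (X.fst, (G.pdeState X).state) := by
  have h1 : G.toPIE.T.finPart a b X.fst X.snd = X.fst := by
    change mv (1 : Matrix (Fin nx) (Fin nx) ℝ) X.fst
      + intV a b (fun θ => mv (0 : Matrix (Fin nx) (XIdx n) ℝ) (X.snd θ)) = X.fst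
    rw [one_mv]
    ext i
    simp [intV_apply]
  have h2 : toL2 a b (G.toPIE.T.distPart a b X.fst X.snd) = (G.pdeState X).state := by
    refine toL2_congr ((ae_restrict_iff' measurableSet_Icc).2
      (Filter.Eventually.of_forall fun s hs => ?_))
    refine Eq.trans ?_ (state_recon G.Gb hs _ _).symm
    rw [← mul_mv]
    rfl
  rw [PIParam.op, h1, h2]

/-- The composition `𝒫[Ξ] 𝒫[Υ]` evaluated at `v = C_v x`, the value of `v` for zero inputs. -/
lemma toPIE_A_op (hab : a ≤ b) (X : RL2 a b (Fin nx) (XIdx n)) :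
    G.toPIE.A.op a b X
      = WithLp.toLp 2 (mv G.Go.A X.fst + mv G.Go.Bxr (G.Gp.out (G.pdeState X)),
          toL2 a b (G.Gp.rhs (G.pdeState X) (mv G.Go.Cv X.fst))) := by
  have h1 : G.toPIE.A.finPart a b X.fst X.snd
      = mv G.Go.A X.fst + mv G.Go.Bxr (G.Gp.out (G.pdeState X)) :=
    G.mv_add_intV_subQ1 hab _ _ X
  have h2 : toL2 a b (G.toPIE.A.distPart a b X.fst X.snd)
      = toL2 a b (G.Gp.rhs (G.pdeState X) (mv G.Go.Cv X.fst)) := by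
    refine toL2_congr ((ae_restrict_iff' measurableSet_Icc).2
      (Filter.Eventually.of_forall fun s hs => ?_))
    refine Eq.trans ?_ (distPart_comp G.Gb G.Gp (mv G.Go.Cv X.fst) X.snd hs)
    simp only [PIParam.distPart, toPIE, mul_mv]
    rfl
  rw [PIParam.op, h1, h2]

lemma toPIE_C1_op (hab : a ≤ b) (X : RL2 a b (Fin nx) (XIdx n)) :
    (G.toPIE.C1.op a b X).fst = mv G.Go.Cz X.fst + mv G.Go.Dzr (G.Gp.out (G.pdeState X)) :=
  G.mv_add_intV_subQ1 hab _ _ X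

lemma toPIE_C2_op (hab : a ≤ b) (X : RL2 a b (Fin nx) (XIdx n)) :
    (G.toPIE.C2.op a b X).fst = mv G.Go.Cy X.fst + mv G.Go.Dyr (G.Gp.out (G.pdeState X)) :=
  G.mv_add_intV_subQ1 hab _ _ X

/-! ### Passing between the two kinds of states -/

/-- `(x, F x̂) ↦ (x, D x̂)`. -/
def jetToPIE (a b : ℝ) (n : Fin (N + 1) → ℕ) (nx : ℕ) :
    RL2 a b (Fin nx) (FIdx n) →L[ℝ] RL2 a b (Fin nx) (XIdx n) :=
  (WithLp.prodContinuousLinearEquiv 2 ℝ _ _).symm.toContinuousLinearMap.comp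
    ((WithLp.fstL 2 ℝ _ _).prod ((topL a b n).comp (WithLp.sndL 2 ℝ _ _)))

/-- `(x, D x̂) ↦ (x, F x̂)`. -/
def pieToJet : RL2 a b (Fin nx) (XIdx n) →L[ℝ] RL2 a b (Fin nx) (FIdx n) :=
  (WithLp.prodContinuousLinearEquiv 2 ℝ _ _).symm.toContinuousLinearMap.comp
    ((WithLp.fstL 2 ℝ _ _).prod (G.Gb.reconL.comp
      (((mvL G.Go.Cv).comp (WithLp.fstL 2 ℝ _ _)).prod (WithLp.sndL 2 ℝ _ _))))

/-- The state `(x, D x̂)` of the associated PIE. -/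
def pieState (x : Vec (Fin nx)) (f : Sob a b n) : RL2 a b (Fin nx) (XIdx n) :=
  WithLp.toLp 2 (x, f.top)

lemma pieToJet_apply (hab : a ≤ b) (X : RL2 a b (Fin nx) (XIdx n)) :
    G.pieToJet X = WithLp.toLp 2 (X.fst, (G.pdeState X).jet) := by
  rw [pdeState, BCParam.jet_recon _ hab]
  rfl

lemma pieState_pdeState (X : RL2 a b (Fin nx) (XIdx n)) :
    pieState X.fst (G.pdeState X) = X := by
  rw [pieState, pdeState, BCParam.top_recon]
  rfl

lemma norm_pieState_le (x : Vec (Fin nx)) (f : Sob a b n) :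
    ‖pieState x f‖ ≤ ‖jetToPIE a b n nx‖ * sobNorm x f :=
  (jetToPIE a b n nx).le_opNorm (WithLp.toLp 2 (x, f.jet))

lemma sobNorm_pdeState_le (hab : a ≤ b) (X : RL2 a b (Fin nx) (XIdx n)) :
    sobNorm X.fst (G.pdeState X) ≤ ‖G.pieToJet‖ * ‖X‖ := by
  rw [sobNorm, ← pieToJet_apply G hab]
  exact G.pieToJet.le_opNorm X

variable {G}

lemma inDomain_zero_iff (x : Vec (Fin nx)) (f : Sob a b n) :
    G.InDomain 0 0 x f ↔ G.Gb.Holds (mv G.Go.Cv x) f := by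
  simp [InDomain]

lemma inDomain_pdeState (hab : a ≤ b) (hadm : G.Gb.Admissible) (X : RL2 a b (Fin nx) (XIdx n)) :
    G.InDomain 0 0 X.fst (G.pdeState X) :=
  (inDomain_zero_iff _ _).2 (BCParam.holds_recon hab hadm _ _)

/-- Almost everywhere equality of `F x̂` together with equality of the boundary values is exactly
what the state, the right-hand side and the output depend on. -/
lemma InDomain.eq_pdeState (hab : a ≤ b) (hadm : G.Gb.Admissible) {x : Vec (Fin nx)}
    {f : Sob a b n} (h : G.InDomain 0 0 x f) :
    f.F =ᵐ[vol a b] (G.pdeState (pieState x f)).F ∧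
      f.bdry = (G.pdeState (pieState x f)).bdry :=
  ((inDomain_zero_iff _ _).1 h).eq_recon hab hadm

lemma InDomain.sobNorm_le (hab : a ≤ b) (hadm : G.Gb.Admissible) {x : Vec (Fin nx)}
    {f : Sob a b n} (h : G.InDomain 0 0 x f) : sobNorm x f ≤ ‖G.pieToJet‖ * ‖pieState x f‖ := by
  have h1 := G.sobNorm_pdeState_le hab (pieState x f)
  rwa [sobNorm, ← Sob.jet_eq (h.eq_pdeState hab hadm).1] at h1

lemma InDomain.T_op (hab : a ≤ b) (hadm : G.Gb.Admissible) {x : Vec (Fin nx)}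
    {f : Sob a b n} (h : G.InDomain 0 0 x f) :
    G.toPIE.T.op a b (pieState x f) = WithLp.toLp 2 (x, f.state) := by
  rw [toPIE_T_op G, ← Sob.state_eq (h.eq_pdeState hab hadm).1]
  rfl

lemma InDomain.out_eq (hab : a ≤ b) (hadm : G.Gb.Admissible) {x : Vec (Fin nx)}
    {f : Sob a b n} (h : G.InDomain 0 0 x f) :
    G.Gp.out (G.pdeState (pieState x f)) = G.Gp.out f :=
  have e := h.eq_pdeState hab hadm
  (G.Gp.out_congr hab e.1 e.2).symm

lemma InDomain.A_op (hab : a ≤ b) (hadm : G.Gb.Admissible) {x : Vec (Fin nx)}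
    {f : Sob a b n} (h : G.InDomain 0 0 x f) :
    G.toPIE.A.op a b (pieState x f) = WithLp.toLp 2 (mv G.Go.A x + mv G.Go.Bxr (G.Gp.out f),
      toL2 a b (G.Gp.rhs f (mv G.Go.Cv x))) := by
  have e := h.eq_pdeState hab hadm
  rw [toPIE_A_op G hab, h.out_eq hab hadm, ← toL2_congr (G.Gp.rhs_congr e.1 e.2 _)]
  rfl

/-! ### Solutions -/

variable {x0 : Vec (Fin nx)} {f0 : Sob a b n} {x : ℝ → Vec (Fin nx)} {f : ℝ → Sob a b n}
  {z : ℝ → Vec (Fin nz)} {y : ℝ → Vec (Fin ny)} {v : ℝ → Vec (Fin nv)} {r : ℝ → Vec (Fin nr)}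

/-- A solution of the GPDE gives a solution of the associated PIE. -/
lemma IsSolution.toPIE (hab : a ≤ b) (hadm : G.Gb.Admissible)
    (h : G.IsSolution x0 f0 0 0 x f z y v r) :
    G.toPIE.IsSolution a b (pieState (x 0) (f 0)) 0 0 (fun t => pieState (x t) (f t)) z y where
  w_mem := L2e_zero
  u_mem := L2e_zero
  Tw_mem := by simpa only [Pi.zero_apply, PIParam.opVec_zero hab] using W1e_zero
  Tu_mem := by simpa only [Pi.zero_apply, PIParam.opVec_zero hab] using W1e_zero
  z_mem := h.z_mem
  y_mem := h.y_mem
  init := rfl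
  state_eq := by
    filter_upwards [h.x_eq, h.f_eq, h.v_eq, h.r_eq, ae_pos] with t hx hf hv hr ht
    simp only [Pi.zero_apply, PIParam.opVec_zero hab, deriv_const, add_zero, sub_zero, mv_zero]
      at hx hv ⊢
    rw [(h.dom t ht.le).A_op hab hadm, ← hr, ← hv]
    refine (hasDerivAt_toLp hx hf).congr_of_eventuallyEq ?_
    filter_upwards [lt_mem_nhds ht] with τ hτ using (h.dom τ hτ.le).T_op hab hadm
  z_eq := by
    filter_upwards [h.z_eq, h.r_eq, ae_pos] with t hz hr ht
    rw [toPIE_C1_op G hab, (h.dom t ht.le).out_eq hab hadm, ← hr]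
    simpa [PIParam.opVec_zero hab, pieState] using hz
  y_eq := by
    filter_upwards [h.y_eq, h.r_eq, ae_pos] with t hy hr ht
    rw [toPIE_C2_op G hab, (h.dom t ht.le).out_eq hab hadm, ← hr]
    simpa [PIParam.opVec_zero hab, pieState] using hy

/-- A strong solution of the GPDE gives a strong solution of the associated PIE. -/
lemma IsStrongSolution.toPIE (hab : a ≤ b) (hadm : G.Gb.Admissible)
    (h : G.IsStrongSolution x0 f0 0 0 x f z y v r) :
    G.toPIE.IsStrongSolution a b (pieState (x 0) (f 0)) 0 0 (fun t => pieState (x t) (f t)) z y where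
  toIsSolution := h.toIsSolution.toPIE hab hadm
  Tx_ac := by
    let e := (WithLp.prodContinuousLinearEquiv 2 ℝ (Vec (Fin nx)) (L2 a b (XIdx n))).symm
    have h1 := (h.x_ac.clm (e.toContinuousLinearMap.comp (ContinuousLinearMap.inl ℝ _ _))
      fun _ _ => rfl).add (h.f_ac.clm (e.toContinuousLinearMap.comp
        (ContinuousLinearMap.inr ℝ _ _)) fun _ _ => rfl)
    -- The identity map replaces the function by one that agrees with it for `t ≥ 0` only.
    refine h1.clm (ContinuousLinearMap.id ℝ _) fun t ht => ?_
    rw [(h.dom t ht).T_op hab hadm]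
    simp [e, ← WithLp.toLp_add]
  x_mem := by
    let e := (WithLp.prodContinuousLinearEquiv 2 ℝ (Vec (Fin nx)) (L2 a b (XIdx n))).symm
    refine ((h.x_ac.l2e.clm (e.toContinuousLinearMap.comp (ContinuousLinearMap.inl ℝ _ _))).add
      ((h.f_mem.clm (topL a b n)).clm (e.toContinuousLinearMap.comp
        (ContinuousLinearMap.inr ℝ _ _)))).congr fun t _ => ?_
    simp [e, ← WithLp.toLp_add, pieState, Sob.top]

variable {X0 : RL2 a b (Fin nx) (XIdx n)} {X : ℝ → RL2 a b (Fin nx) (XIdx n)}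

/-- A locally square integrable solution of the associated PIE gives a solution of the GPDE. -/
lemma isSolution_of_toPIE (hab : a ≤ b) (hadm : G.Gb.Admissible)
    (h : G.toPIE.IsSolution a b X0 0 0 X z y) (hX : L2e X) :
    G.IsSolution (X 0).fst (G.pdeState (X 0)) 0 0 (fun t => (X t).fst) (fun t => G.pdeState (X t))
      z y (fun t => mv G.Go.Cv (X t).fst) (fun t => G.Gp.out (G.pdeState (X t))) where
  init_dom := inDomain_pdeState hab hadm _
  w_mem := L2e_zero
  u_mem := L2e_zero
  Bw_mem := by simpa only [Pi.zero_apply, mv_zero] using W1e_zero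
  Bu_mem := by simpa only [Pi.zero_apply, mv_zero] using W1e_zero
  z_mem := h.z_mem
  y_mem := h.y_mem
  -- Square integrability of `X` in time is used only for `v` and `r`; both depend continuously and
  -- linearly on the PIE state.
  v_mem := (hX.clm (WithLp.fstL 2 ℝ _ _)).clm (mvL G.Go.Cv)
  r_mem := by
    refine (((hX.clm (WithLp.fstL 2 ℝ _ _)).clm ((mvL G.sub.P).comp (mvL G.Go.Cv))).add
      ((hX.clm (WithLp.sndL 2 ℝ _ _)).clm (kernelL (G.memL2_subQ1 hab)))).congr fun t _ => ?_
    rw [out_pdeState G hab, kernelL_apply hab]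
    rfl
  dom := fun t _ => inDomain_pdeState hab hadm _
  init_x := rfl
  init_f := rfl
  x_eq := by
    filter_upwards [h.state_eq] with t ht
    simp only [Pi.zero_apply, PIParam.opVec_zero hab, deriv_const, add_zero, sub_zero, mv_zero,
      toPIE_T_op G, toPIE_A_op G hab] at ht ⊢
    exact (WithLp.fstL 2 ℝ _ _).hasFDerivAt.comp_hasDerivAt t ht
  z_eq := by
    filter_upwards [h.z_eq] with t ht
    simpa [PIParam.opVec_zero hab, toPIE_C1_op G hab] using ht
  y_eq := by
    filter_upwards [h.y_eq] with t ht
    simpa [PIParam.opVec_zero hab, toPIE_C2_op G hab] using ht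
  v_eq := Filter.Eventually.of_forall fun t => by simp
  f_eq := by
    filter_upwards [h.state_eq] with t ht
    simp only [Pi.zero_apply, PIParam.opVec_zero hab, deriv_const, add_zero, sub_zero,
      toPIE_T_op G, toPIE_A_op G hab] at ht
    exact (WithLp.sndL 2 ℝ _ _).hasFDerivAt.comp_hasDerivAt t ht
  r_eq := Filter.Eventually.of_forall fun t => rfl

/-- A strong solution of the associated PIE gives a strong solution of the GPDE. -/
lemma isStrongSolution_of_toPIE (hab : a ≤ b) (hadm : G.Gb.Admissible)
    (h : G.toPIE.IsStrongSolution a b X0 0 0 X z y) :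
    G.IsStrongSolution (X 0).fst (G.pdeState (X 0)) 0 0 (fun t => (X t).fst)
      (fun t => G.pdeState (X t)) z y (fun t => mv G.Go.Cv (X t).fst)
      (fun t => G.Gp.out (G.pdeState (X t))) where
  toIsSolution := isSolution_of_toPIE hab hadm h.toIsSolution h.x_mem
  x_ac := h.Tx_ac.clm (WithLp.fstL 2 ℝ _ _) fun t _ => by rw [toPIE_T_op G]; rfl
  f_ac := h.Tx_ac.clm (WithLp.sndL 2 ℝ _ _) fun t _ => by rw [toPIE_T_op G]; rfl
  f_mem := ((h.x_mem.clm G.pieToJet).clm (WithLp.sndL 2 ℝ _ _)).congr fun t _ => by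
    rw [pieToJet_apply G hab]; rfl

/-! ### Exponential bounds -/

/-- An exponential bound for PIE states implies one for the corresponding GPDE states. -/
lemma sobNorm_bound (hab : a ≤ b) (hadm : G.Gb.Admissible)
    (h : G.IsSolution x0 f0 0 0 x f z y v r) {M e t : ℝ} (hM : 0 < M) (he : 0 < e) (ht : 0 ≤ t)
    (hb : ‖pieState (x t) (f t)‖ ≤ M * ‖pieState (x 0) (f 0)‖ * e) :
    sobNorm (x t) (f t) ≤ (‖G.pieToJet‖ + 1) * M * (‖jetToPIE a b n nx‖ + 1) * sobNorm x0 f0 * e := by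
  have h0 : sobNorm (x 0) (f 0) = sobNorm x0 f0 := by rw [sobNorm, sobNorm, h.init_x, h.init_f]
  have h1 := (h.dom t ht).sobNorm_le hab hadm
  have h2 := norm_pieState_le (x 0) (f 0)
  rw [h0] at h2
  have hs : 0 ≤ sobNorm x0 f0 := norm_nonneg _
  calc sobNorm (x t) (f t) ≤ ‖G.pieToJet‖ * ‖pieState (x t) (f t)‖ := h1
    -- Adding `1` to the operator norms keeps the final constant positive even if an operator
    -- vanishes.
    _ ≤ (‖G.pieToJet‖ + 1) * (M * ((‖jetToPIE a b n nx‖ + 1) * sobNorm x0 f0) * e) := by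
        gcongr
        · linarith
        · exact hb.trans (by gcongr; exact h2.trans (by gcongr; linarith))
    _ = _ := by ring

/-- An exponential bound for GPDE states implies one for the corresponding PIE states. -/
lemma norm_bound (hab : a ≤ b) {M e : ℝ} (hM : 0 < M) (he : 0 < e)
    {Y Y0 : RL2 a b (Fin nx) (XIdx n)}
    (hb : sobNorm Y.fst (G.pdeState Y) ≤ M * sobNorm Y0.fst (G.pdeState Y0) * e) :
    ‖Y‖ ≤ (‖jetToPIE a b n nx‖ + 1) * M * (‖G.pieToJet‖ + 1) * ‖Y0‖ * e := by
  have h1 := norm_pieState_le Y.fst (G.pdeState Y)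
  rw [pieState_pdeState] at h1
  have h2 := G.sobNorm_pdeState_le hab Y0
  calc ‖Y‖ ≤ ‖jetToPIE a b n nx‖ * sobNorm Y.fst (G.pdeState Y) := h1
    _ ≤ (‖jetToPIE a b n nx‖ + 1) * (M * ((‖G.pieToJet‖ + 1) * ‖Y0‖) * e) := by
        have : 0 ≤ sobNorm Y.fst (G.pdeState Y) := norm_nonneg _
        gcongr
        · linarith
        · exact hb.trans (by gcongr; exact h2.trans (by gcongr; linarith))
    _ = _ := by ring

end Model

/-- The differential equation of a PIE only constrains a solution at almost every time, so that a
solution may be replaced by zero except at two given times. Unlike the solution itself, the result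
is locally square integrable. -/
lemma PIESystem.IsSolution.truncate {nx nw nu nz ny : ℕ} {ι : Type} [Fintype ι]
    {S : PIESystem nx ι nw nu nz ny} {a b : ℝ} (hab : a ≤ b) {X0 : RL2 a b (Fin nx) ι}
    {X : ℝ → RL2 a b (Fin nx) ι} {z : ℝ → Vec (Fin nz)} {y : ℝ → Vec (Fin ny)}
    (h : S.IsSolution a b X0 0 0 X z y) (T : ℝ) :
    S.IsSolution a b X0 0 0 (({0, T} : Set ℝ).indicator X) 0 0 ∧
      L2e (({0, T} : Set ℝ).indicator X) := by
  have hfin : ({0, T} : Set ℝ).Finite := by simp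
  have hae : ∀ᵐ t, t ∉ ({0, T} : Set ℝ) := hfin.countable.ae_notMem _
  refine ⟨?_, fun τ => ?_⟩
  · refine ⟨L2e_zero, L2e_zero, h.Tw_mem, h.Tu_mem, L2e_zero, L2e_zero, ?_, ?_, ?_, ?_⟩
    · rw [indicator_of_mem (by simp)]
      exact h.init
    · filter_upwards [ae_restrict_of_ae hae] with t ht
      simp only [Pi.zero_apply, PIParam.opVec_zero hab, PIParam.op_zero hab, deriv_const, add_zero,
        sub_zero, indicator_of_notMem ht]
      refine (hasDerivAt_const t (0 : RL2 a b (Fin nx) ι)).congr_of_eventuallyEq ?_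
      -- The two exceptional times form a closed set, so the truncated solution vanishes near any
      -- other time and its derivative there is zero.
      filter_upwards [hfin.isClosed.isOpen_compl.mem_nhds ht] with τ hτ
      rw [indicator_of_notMem hτ, PIParam.op_zero hab]
    · filter_upwards [ae_restrict_of_ae hae] with t ht
      simp [PIParam.opVec_zero hab, PIParam.op_zero hab, indicator_of_notMem ht]
    · filter_upwards [ae_restrict_of_ae hae] with t ht
      simp [PIParam.opVec_zero hab, PIParam.op_zero hab, indicator_of_notMem ht]
  · exact (memLp_congr_ae (ae_restrict_of_ae (hae.mono fun t ht =>
      (indicator_of_notMem ht X).symm))).1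
      (MemLp.zero' : MemLp (fun _ : ℝ => (0 : RL2 a b (Fin nx) ι)) 2 (volume.restrict (Icc 0 τ)))

end GPDE

end

/-! ### Equivalence of exponential stability -/

theorem theorem4 {N : ℕ} {a b : ℝ} (hab : a < b) (n : Fin (N + 1) → ℕ)
    {nBC nx nw nu nr nz ny nv : ℕ} (G : GPDE.Model a b n nBC nx nw nu nr nz ny nv)
    (hadm : G.Gb.Admissible) :
    (G.ExpStable ↔ G.toPIE.ExpStable a b) ∧
      (G.ExpStableStrong ↔ G.toPIE.ExpStableStrong a b) := by
  have hle := hab.le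
  refine ⟨⟨?_, ?_⟩, ⟨?_, ?_⟩⟩
  · rintro ⟨M, α, hM, hα, H⟩
    refine ⟨_, α, by positivity, hα, fun X0 X z y h t ht =>
      GPDE.Model.norm_bound (G := G) hle hM (Real.exp_pos _) ?_⟩
    -- The truncation is made at the very time `t` of the estimate, so that it retains the original
    -- values at both `0` and `t`.
    obtain ⟨h', hX⟩ := h.truncate hle t
    have hs := GPDE.Model.isSolution_of_toPIE hle hadm h' hX
    have hb := H _ _ hs.init_dom _ _ _ _ _ _ hs t ht
    rwa [Set.indicator_of_mem (by simp), Set.indicator_of_mem (by simp), h.init] at hb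
  · rintro ⟨M, α, hM, hα, H⟩
    exact ⟨_, α, by positivity, hα, fun x0 f0 _ x f z y v r h t ht =>
      GPDE.Model.sobNorm_bound hle hadm h hM (Real.exp_pos _) ht
        (H _ _ _ _ (h.toPIE hle hadm) t ht)⟩
  · rintro ⟨M, α, hM, hα, H⟩
    refine ⟨_, α, by positivity, hα, fun X0 X z y h t ht =>
      GPDE.Model.norm_bound (G := G) hle hM (Real.exp_pos _) ?_⟩
    have hs := GPDE.Model.isStrongSolution_of_toPIE hle hadm h
    have hb := H _ _ hs.init_dom _ _ _ _ _ _ hs t ht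
    rwa [h.init] at hb
  · rintro ⟨M, α, hM, hα, H⟩
    exact ⟨_, α, by positivity, hα, fun x0 f0 _ x f z y v r h t ht =>
      GPDE.Model.sobNorm_bound hle hadm h.toIsSolution hM (Real.exp_pos _) ht
        (H _ _ _ _ (h.toPIE hle hadm) t ht)⟩
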